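/- For $a,b\in\mathbb R$ let $\Lambda=\Lambda_{a,b}(x,y)=(-a|x|-by+(a-b-1),\,x)$ be the Lozi map and, for $\sigma\in\{-1,+1\}$, let $\Lambda_\sigma(x,y)=(-\sigma ax-by+(a-b-1),\,x)$ be its affine branches. Let $\pi_1(x,y)=x$. For a finite itinerary $I=(I_1,\dots,I_p)\in\{-1,+1\}^p$ put $\Lambda_I=\Lambda_{I_p}\circ\dots\circ\Lambda_{I_1}$. A point $\theta$ is a formal $I$-periodic point if $\Lambda_I(\theta)=\theta$. It is $I$-admissible if $I_{k+1}\,\pi_1\Lambda_{(I_1,\dots,I_k)}(\theta)\ge 0$ for $0\le k<p$. A formal $I$-periodic point is hyperbolic if it is $I$-admissible and $\pi_1\Lambda^k(\theta)\ne0$ for $0\le k<p$. For $m,n\ge2$ let $$\iota_{\sigma,m,n}=(+\,\underbrace{-\cdots-}_{m-2}\,+\,+\,\underbrace{-\cdots-}_{n-2}\,\sigma).$$ A parameter $(a,b)$ is an $\iota_{\pm,m,n}$-bifurcation parameter (border collision) if some point $\theta$ is an admissible formal periodic point for both $\iota_{-,m,n}$ and $\iota_{+,m,n}$, with $\pi_1\Lambda^{m+n-1}(\theta)=0$.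 Let $I^V=[-1,1]$, let $\zeta_+=1-\frac{2(b+1)}{a+b+1}$ and let $z_+=(\zeta_+,\zeta_+)$ be the corresponding fixed point. Let $W^S(z_+)$ be its stable set and let $W^S_0(z_+)$ be the line segment of $W^S(z_+)$ containing $z_+$. For $\omega\subset\mathbb R^2$ put $\Pi_\sigma(\omega)=\Lambda_\sigma^{-1}(\omega)\cap(\mathbb R\times I^V)$. Define $\beta_1=W_0^S(z_+)\cap(\mathbb R\times I^V)$, $\beta_k=\Pi_-(\beta_{k-1})$ for $k\ge2$, and $\gamma_k=\Pi_+(\beta_k)$ for $k\ge1$. A vertical segment is the graph $x=h(y)$, $y\in I^V$, of an affine function $h$. A vertical strip $V(\alpha,\beta)$ is the closed region of $\mathbb R\times I^V$ between two disjoint vertical segments $\alpha,\beta$. For $m,n\ge 2$ put $C_m=V(\gamma_{m-1},\gamma_m)$, $U_m=\Lambda^m(C_m)$ and $C_{m,n}=\{v\in C_m:\Lambda^m(v)\in U_m\cap C_n\}$. If $C_{m,n}$ is the union of two disjoint vertical strips, $C_{m,n}^L$ denotes the left one, and one says that $C_{m,n}^L$ exists. For $\bar b\in(0,1)$ let $P_{\mathrm{nbd}}(\bar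 b)=\{(a,b):a>3b+1,\ 0\le b\le\bar b\}$. **Theorem.** For every integer $N\ge2$ there are $\bar b\in(0,1)$ and an integer $M\ge N+2$ such that for all $m\ge M$ and $2\le n\le N$ there is an analytic curve $l_{m,n}:[0,\bar b]\to(\sqrt2,4)$ whose graph $\{a=l_{m,n}(b)\}$ lies in $P_{\mathrm{nbd}}(\bar b)$ and such that, for every $(a,b)\in P_{\mathrm{nbd}}(\bar b)$, there is for each $\sigma\in\{-1,+1\}$ exactly one formal $\iota_{\sigma,m,n}$-periodic point $\theta_{\sigma,m,n}$, and the following hold. 1. If $a>l_{m,n}(b)$, then for each $\sigma$ the point $\theta_{\sigma,m,n}$ is hyperbolic, $C_{m,n}^L$ exists, and $\theta_{\sigma,m,n}\in C_{m,n}^L$. 2. If $a=l_{m,n}(b)$, then $(a,b)$ is an $\iota_{\pm,m,n}$-bifurcation parameter. In particular, $\theta_{-,m,n}$ and $\theta_{+,m,n}$ are admissible, $C_{m,n}^L$ exists, $\theta_{-,m,n}=\theta_{+,m,n}\in C_{m,n}^L$, and $\pi_1\Lambda^{m+n-1}(\theta_{\sigma,m,n})=0$ for each $\sigma$. 3. If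 $a<l_{m,n}(b)$, then for each $\sigma$ the point $\theta_{\sigma,m,n}$ is not admissible. -/

import Mathlib

open Set Filter Topology

namespace Lozi

/-- The Lozi map `Λ(x, y) = (-a|x| - b y + (a - b - 1), x)`. -/
noncomputable def map (a b : ℝ) (v : ℝ × ℝ) : ℝ × ℝ :=
  (-a * |v.1| - b * v.2 + (a - b - 1), v.1)

/-- The sign `σ ∈ S = {-1, +1}` as a real number. -/
def sgn (σ : ℤˣ) : ℝ := ((σ : ℤ) : ℝ)

/-- The affine branch `Λ_σ(x, y) = (-σ a x - b y + (a - b - 1), x)`. -/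
noncomputable def branch (a b : ℝ) (σ : ℤˣ) (v : ℝ × ℝ) : ℝ × ℝ :=
  (-(sgn σ) * a * v.1 - b * v.2 + (a - b - 1), v.1)

/-- The parameter space `{(a, b) ; a > 3 b + 1, 0 ≤ b ≤ 1}`. -/
def Pmod : Set (ℝ × ℝ) := {p | p.1 > 3 * p.2 + 1 ∧ 0 ≤ p.2 ∧ p.2 ≤ 1}

/-- The neighbourhood of the tent family. -/
def Pnbd (bbar : ℝ) : Set (ℝ × ℝ) := Pmod ∩ {p | 0 ≤ p.2 ∧ p.2 ≤ bbar}

/-! ### Itineraries and formal periodic points -/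

/-- `Λ_I = Λ_{I_N} ∘ ⋯ ∘ Λ_{I_1}` for a finite itinerary `I = (I_1, …, I_N)`. -/
noncomputable def formalIter (a b : ℝ) (I : List ℤˣ) (v : ℝ × ℝ) : ℝ × ℝ :=
  I.foldl (fun p σ => branch a b σ p) v

/-- `θ` is a formal `I`-periodic point: `θ = Λ_I(θ)`. -/
def IsFormalPeriodic (a b : ℝ) (I : List ℤˣ) (θ : ℝ × ℝ) : Prop :=
  θ = formalIter a b I θ

/-- `θ` is `I`-admissible: the first coordinate of `Λ_{(I_1, …, I_k)}(θ)` belongs to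
`I_{k+1} · [0, ∞)` for `0 ≤ k < l(I)` (the list is indexed from `0`). -/
def IsAdmissible (a b : ℝ) (I : List ℤˣ) (θ : ℝ × ℝ) : Prop :=
  ∀ (k : ℕ) (hk : k < I.length), 0 ≤ sgn (I[k]) * (formalIter a b (I.take k) θ).1

/-- A formal `I`-periodic point is hyperbolic if it is `I`-admissible and its orbit
`θ, Λ(θ), …, Λ^{l(I)-1}(θ)` avoids the critical locus `x = 0`. -/
def IsHyperbolic (a b : ℝ) (I : List ℤˣ) (θ : ℝ × ℝ) : Prop :=
  IsFormalPeriodic a b I θ ∧ IsAdmissible a b I θ ∧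
    ∀ k : ℕ, k < I.length → ((map a b)^[k] θ).1 ≠ 0

/-- The parameter `(a, b)` is a (border collision) bifurcation parameter of the pair of
itineraries `(J, ±)`: there is a common admissible formal periodic point of both itineraries,
whose orbit hits the critical locus at the time of the last symbol. -/
def IsBifurcationParameter (a b : ℝ) (J : List ℤˣ) : Prop :=
  ∃ θ : ℝ × ℝ, (∀ σ : ℤˣ, IsFormalPeriodic a b (J ++ [σ]) θ ∧ IsAdmissible a b (J ++ [σ]) θ) ∧
    ((map a b)^[J.length] θ).1 = 0

/-- The itinerary `(+ (-)^{m-2} + + (-)^{n-2})`, which is `ι_{σ,m,n}` without its last symbol. -/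
def iotaStem (m n : ℕ) : List ℤˣ :=
  [1] ++ List.replicate (m - 2) (-1) ++ [1, 1] ++ List.replicate (n - 2) (-1)

/-- The itinerary `ι_{σ,m,n} = (+ (-)^{m-2} + + (-)^{n-2} σ)` of length `m + n`. -/
def iota (σ : ℤˣ) (m n : ℕ) : List ℤˣ := iotaStem m n ++ [σ]

/-! ### The renormalization model -/

/-- The horizontal strip `ℝ × I^V` with `I^V = [-1, 1]`. -/
def strip : Set (ℝ × ℝ) := {v | v.2 ∈ Icc (-1 : ℝ) 1}

/-- The coordinate `ζ_+` of the fixed point `z_+ = (ζ_+, ζ_+)`. -/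
noncomputable def zetaPlus (a b : ℝ) : ℝ := 1 - 2 * (b + 1) / (a + b + 1)

/-- The fixed point `z_+`. -/
noncomputable def zPlus (a b : ℝ) : ℝ × ℝ := (zetaPlus a b, zetaPlus a b)

/-- The stable set `W^S(z)` of a fixed point `z`. -/
def stableSet (a b : ℝ) (z : ℝ × ℝ) : Set (ℝ × ℝ) :=
  {v | Tendsto (fun k : ℕ => (map a b)^[k] v) atTop (𝓝 z)}

/-- The line segment `W_0^S(z)` of `W^S(z)` containing `z`: the points that are joined to `z` by
a segment inside `W^S(z)`. -/
def localStable (a b : ℝ) (z : ℝ × ℝ) : Set (ℝ × ℝ) :=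
  {v | segment ℝ z v ⊆ stableSet a b z}

/-- The pullback `Π_σ(ω) = Λ_σ⁻¹(ω) ∩ (ℝ × I^V)`. -/
def pullback (a b : ℝ) (σ : ℤˣ) (ω : Set (ℝ × ℝ)) : Set (ℝ × ℝ) :=
  branch a b σ ⁻¹' ω ∩ strip

/-- The segments `β_m`: `β_1 = W_0^S(z_+) ∩ (ℝ × I^V)` and `β_m = Π_-(β_{m-1})` for `m ≥ 2`.
(The value at `0` is not used.) -/
def beta (a b : ℝ) : ℕ → Set (ℝ × ℝ)
  | 0 => ∅
  | 1 => localStable a b (zPlus a b) ∩ strip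
  | m + 2 => pullback a b (-1) (beta a b (m + 1))

/-- The segments `γ_m = Π_+(β_m)` for `m ≥ 1`. -/
def gamma (a b : ℝ) (m : ℕ) : Set (ℝ × ℝ) := pullback a b 1 (beta a b m)

/-- `α` is a vertical segment on `I^V`: in `ℝ × I^V` it is the graph `x = h(y)` of an affine
function `h(y) = s y + c`. -/
def IsVerticalSegment (α : Set (ℝ × ℝ)) : Prop :=
  ∃ s c : ℝ, α ∩ strip = {v | v ∈ strip ∧ v.1 = s * v.2 + c}

/-- The region `V(α, β) ⊂ ℝ × I^V` between the vertical segments `α` and `β`, including them. -/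
def between (α β : Set (ℝ × ℝ)) : Set (ℝ × ℝ) :=
  {v | v ∈ strip ∧ ∃ x₁ x₂ : ℝ, (x₁, v.2) ∈ α ∧ (x₂, v.2) ∈ β ∧ v.1 ∈ uIcc x₁ x₂}

/-- A vertical strip is a set `V(α, β)` with `α` and `β` disjoint vertical segments. -/
def IsVerticalStrip (V : Set (ℝ × ℝ)) : Prop :=
  ∃ α β : Set (ℝ × ℝ), IsVerticalSegment α ∧ IsVerticalSegment β ∧
    Disjoint (α ∩ strip) (β ∩ strip) ∧ V = between α β

/-- `C_m = V(γ_{m-1}, γ_m)` for `m ≥ 2`. -/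
def C (a b : ℝ) (m : ℕ) : Set (ℝ × ℝ) := between (gamma a b (m - 1)) (gamma a b m)

/-- `U_m = Λ^m(C_m)`. -/
def U (a b : ℝ) (m : ℕ) : Set (ℝ × ℝ) := (map a b)^[m] '' C a b m

/-- The subpartition `C_{m,n}` of `C_m`: the points of `C_m` sent into `U_m ∩ C_n` by `Λ^m`. -/
def Cmn (a b : ℝ) (m n : ℕ) : Set (ℝ × ℝ) :=
  C a b m ∩ (map a b)^[m] ⁻¹' (U a b m ∩ C a b n)

/-- `X` is the union of two disjoint vertical strips, `L` on the left and `R` on the right. -/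
def IsLeftRight (X L R : Set (ℝ × ℝ)) : Prop :=
  IsVerticalStrip L ∧ IsVerticalStrip R ∧ X = L ∪ R ∧
    ∀ p ∈ L, ∀ q ∈ R, p.2 = q.2 → p.1 < q.1

/-- The left component `C_{m,n}^L` of `C_{m,n}`. A membership `v ∈ CmnL a b m n` includes that
`C_{m,n}^L` exists, i.e. that `C_{m,n}` is the union of two disjoint vertical strips. -/
def CmnL (a b : ℝ) (m n : ℕ) : Set (ℝ × ℝ) :=
  {v | ∃ L R : Set (ℝ × ℝ), IsLeftRight (Cmn a b m n) L R ∧ v ∈ L}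

end Lozi

/-! The first coordinates of an orbit along a prescribed itinerary form a sequence `w` solving a
second-order affine recursion. When `a > 1 + |b|` such sequences obey a discrete maximum principle,
so they are controlled by their two boundary values. Hence formal periodic points exist and are
unique (with coordinates in `[-1, 1]` when `b ≥ 0`), and for the stem `J` of `ι` exactly one point
`(x, 0)` has a formal orbit along `J` ending on the critical locus.

The two branches agree on `x = 0`, so closing this critical orbit by one more step leaves a mismatch
`gap` that does not depend on the last symbol `σ`. If `t` is the coordinate of the periodic orbit
that carries the last symbol, comparison with the critical orbit gives `|gap - σ a t| ≤ (1 + |b|)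
|t|` (`gap_sub_le`). Thus `gap` and `σ t` have the same sign, for both `σ` at once, and the
trichotomy of the theorem is the sign of `gap`.

The long block of minus signs pins the orbit near the fixed point `(-1, -1)` of `Λ_-`, so the
critical orbit starts near `x = 1` and `gap` is close to `a - 2`. It is expanding in `a ≥ 3/2`
(`gap_expanding`) and negative for smaller `a` (`gap_neg_of_le`), so its zero set is a graph,
analytic by the implicit function theorem.

If `gap ≥ 0`, then `a` is at least `2` up to an error small compared with `3 ^ (-N)`. All signs but
the last then follow by solving the recursion backwards (`hasIotaSigns_of_periodic`), and pulling
affine lines back through the branches exhibits `C_{m,n}` as two strips (`isLeftRight_Cmn`), the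
left one containing the periodic points. -/

namespace Lozi

/-! ### A discrete maximum principle -/

/-- At an interior index where `|w|` is maximal with value `X > B`, the inequality gives `(a - 1 -
|b|) X ≤ K`, a contradiction. A boundary value may instead repeat an interior one; this alternative
serves periodic sequences. -/
theorem max_principle {a b K B : ℝ} {p : ℕ} {w : ℕ → ℝ} (hab : 1 + |b| < a)
    (hK : K ≤ (a - 1 - |b|) * B)
    (hw : ∀ k < p, a * |w (k + 1)| ≤ K + |w (k + 2)| + |b| * |w k|)
    (h0 : |w 0| ≤ B ∨ ∃ i < p, w 0 = w (i + 1))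
    (h1 : |w (p + 1)| ≤ B ∨ ∃ i < p, w (p + 1) = w (i + 1)) :
    ∀ k ≤ p + 1, |w k| ≤ B := by
  rcases Nat.eq_zero_or_pos p with rfl | hp
  · intro k hk
    interval_cases k
    · simpa using h0
    · simpa using h1
  obtain ⟨j, hj, hmax⟩ := Finset.exists_max_image (Finset.range p) (fun i => |w (i + 1)|)
    ⟨0, by simpa using hp⟩
  simp only [Finset.mem_range] at hj hmax
  have key : |w (j + 1)| ≤ B := by
    by_contra! hlt
    have all : ∀ k ≤ p + 1, |w k| ≤ |w (j + 1)| := by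
      intro k hk
      rcases Nat.eq_zero_or_pos k with rfl | hk0
      · rcases h0 with h | ⟨i, hi, h⟩
        · linarith
        · rw [h]; exact hmax i hi
      · rcases Nat.lt_or_ge k (p + 1) with h | h
        · have := hmax (k - 1) (by omega)
          rwa [Nat.sub_add_cancel hk0] at this
        · obtain rfl : k = p + 1 := by omega
          rcases h1 with h | ⟨i, hi, h⟩
          · linarith
          · rw [h]; exact hmax i hi
    have h2 := hw j hj
    have h3 := all (j + 2) (by omega)
    have h4 := mul_le_mul_of_nonneg_left (all j (by omega)) (abs_nonneg b)
    nlinarith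
  intro k hk
  rcases Nat.eq_zero_or_pos k with rfl | hk0
  · rcases h0 with h | ⟨i, hi, h⟩
    · exact h
    · rw [h]; exact (hmax i hi).trans key
  · rcases Nat.lt_or_ge k (p + 1) with h | h
    · have := hmax (k - 1) (by omega)
      rw [Nat.sub_add_cancel hk0] at this
      exact this.trans key
    · obtain rfl : k = p + 1 := by omega
      rcases h1 with h | ⟨i, hi, h⟩
      · exact h
      · rw [h]; exact (hmax i hi).trans key

/-- A second order recursion with signs satisfies the hypothesis of the maximum principle. -/
theorem abs_rec_le {a b e K x y z r : ℝ} (ha : 0 < a) (he : |e| = 1) (hr : |r| ≤ K)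
    (h : z = -e * a * y - b * x + r) : a * |y| ≤ K + |z| + |b| * |x| := by
  have h1 : e * (a * y) = r - z - b * x := by rw [h]; ring
  have h2 : a * |y| = |r - z - b * x| := by
    rw [← h1, abs_mul, he, abs_mul, abs_of_pos ha, one_mul]
  rw [h2, ← abs_mul]
  calc |r - z - b * x| ≤ |r - z| + |b * x| := abs_sub _ _
    _ ≤ |r| + |z| + |b * x| := by gcongr; exact abs_sub _ _
    _ ≤ _ := by gcongr

theorem sgn_one : sgn 1 = 1 := by simp [sgn]

theorem sgn_neg_one : sgn (-1) = -1 := by simp [sgn]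

theorem abs_sgn (σ : ℤˣ) : |sgn σ| = 1 := by
  rcases Int.units_eq_one_or σ with rfl | rfl <;> simp [sgn]

/-! ### Orbits along an itinerary -/

/-- The sequence of first coordinates along the formal orbit of `v`, preceded by the second
coordinate of `v`. -/
noncomputable def orbitSeq (a b : ℝ) (I : List ℤˣ) (v : ℝ × ℝ) : ℕ → ℝ
  | 0 => v.2
  | k + 1 => (formalIter a b (I.take k) v).1

theorem formalIter_nil (a b : ℝ) (v : ℝ × ℝ) : formalIter a b [] v = v := rfl

theorem formalIter_cons (a b : ℝ) (σ : ℤˣ) (I : List ℤˣ) (v : ℝ × ℝ) :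
    formalIter a b (σ :: I) v = formalIter a b I (branch a b σ v) := rfl

theorem formalIter_append (a b : ℝ) (I J : List ℤˣ) (v : ℝ × ℝ) :
    formalIter a b (I ++ J) v = formalIter a b J (formalIter a b I v) := by
  simp [formalIter, List.foldl_append]

theorem formalIter_take_succ (a b : ℝ) (I : List ℤˣ) (v : ℝ × ℝ) {k : ℕ} (hk : k < I.length) :
    formalIter a b (I.take (k + 1)) v = branch a b I[k] (formalIter a b (I.take k) v) := by
  rw [← List.take_append_getElem hk, formalIter_append]
  rfl

theorem formalIter_take_snd (a b : ℝ) (I : List ℤˣ) (v : ℝ × ℝ) {k : ℕ} (hk : k ≤ I.length) :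
    (formalIter a b (I.take k) v).2 = orbitSeq a b I v k := by
  cases k with
  | zero => rfl
  | succ k => rw [formalIter_take_succ a b I v hk]; rfl

theorem orbitSeq_rec (a b : ℝ) (I : List ℤˣ) (v : ℝ × ℝ) {k : ℕ} (hk : k < I.length) :
    orbitSeq a b I v (k + 2) = -(sgn I[k]) * a * orbitSeq a b I v (k + 1)
      - b * orbitSeq a b I v k + (a - b - 1) := by
  rw [← formalIter_take_snd a b I v hk.le]
  change (formalIter a b (I.take (k + 1)) v).1 = _
  rw [formalIter_take_succ a b I v hk]
  rfl

theorem orbitSeq_length (a b : ℝ) (I : List ℤˣ) (v : ℝ × ℝ) :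
    orbitSeq a b I v I.length = (formalIter a b I v).2 := by
  rw [← formalIter_take_snd a b I v le_rfl, List.take_length]

theorem orbitSeq_length_succ (a b : ℝ) (I : List ℤˣ) (v : ℝ × ℝ) :
    orbitSeq a b I v (I.length + 1) = (formalIter a b I v).1 := by
  simp [orbitSeq]

theorem orbitSeq_append (a b : ℝ) (I J : List ℤˣ) (v : ℝ × ℝ) {k : ℕ} (hk : k ≤ I.length + 1) :
    orbitSeq a b (I ++ J) v k = orbitSeq a b I v k := by
  cases k with
  | zero => rfl
  | succ k => simp [orbitSeq, List.take_append_of_le_length (Nat.le_of_succ_le_succ hk)]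

/-- The difference of two orbits along the same itinerary solves the homogeneous recursion. -/
theorem orbitSeq_sub_le {a b : ℝ} (ha : 0 < a) (I : List ℤˣ) (v w : ℝ × ℝ) :
    ∀ k < I.length, a * |orbitSeq a b I v (k + 1) - orbitSeq a b I w (k + 1)| ≤
      0 + |orbitSeq a b I v (k + 2) - orbitSeq a b I w (k + 2)|
        + |b| * |orbitSeq a b I v k - orbitSeq a b I w k| := by
  intro k hk
  refine abs_rec_le (e := sgn I[k]) (r := 0) ha (abs_sgn _) (by simp) ?_
  rw [orbitSeq_rec a b I v hk, orbitSeq_rec a b I w hk]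
  ring

/-! ### Linear parts and unique formal periodic points. -/

/-- The linear part of a branch. -/
noncomputable def branchLin (a b : ℝ) (σ : ℤˣ) : ℝ × ℝ →ₗ[ℝ] ℝ × ℝ where
  toFun v := (-(sgn σ) * a * v.1 - b * v.2, v.1)
  map_add' v w := by ext <;> simp; ring
  map_smul' r v := by ext <;> simp; ring

/-- The linear part of `formalIter`. -/
noncomputable def linIter (a b : ℝ) : List ℤˣ → (ℝ × ℝ →ₗ[ℝ] ℝ × ℝ)
  | [] => LinearMap.id
  | σ :: I => (linIter a b I).comp (branchLin a b σ)

theorem formalIter_add (a b : ℝ) (I : List ℤˣ) (v w : ℝ × ℝ) :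
    formalIter a b I (v + w) = linIter a b I v + formalIter a b I w := by
  induction I generalizing v w with
  | nil => rfl
  | cons σ I ih =>
    rw [formalIter_cons, formalIter_cons]
    have : branch a b σ (v + w) = branchLin a b σ v + branch a b σ w := by
      ext <;> simp [branch, branchLin]; ring
    rw [this, ih]; rfl

theorem formalIter_eq_linIter_add (a b : ℝ) (I : List ℤˣ) (v : ℝ × ℝ) :
    formalIter a b I v = linIter a b I v + formalIter a b I 0 := by
  simpa using formalIter_add a b I v 0

theorem orbitSeq_zero_eq_of_periodic {a b : ℝ} {I : List ℤˣ} {v : ℝ × ℝ}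
    (h : IsFormalPeriodic a b I v) : orbitSeq a b I v 0 = orbitSeq a b I v I.length := by
  rw [orbitSeq_length, ← h]; rfl

theorem orbitSeq_one_eq_of_periodic {a b : ℝ} {I : List ℤˣ} {v : ℝ × ℝ}
    (h : IsFormalPeriodic a b I v) : orbitSeq a b I v (I.length + 1) = orbitSeq a b I v 1 := by
  rw [orbitSeq_length_succ, ← h]; rfl

/-- Periodicity is the linear system `(L - id) v = -Λ_I(0)`. A kernel vector gives a periodic
solution of the homogeneous recursion, which vanishes by the maximum principle with `K = B = 0`. -/
theorem existsUnique_formalPeriodic {a b : ℝ} (hab : 1 + |b| < a) {I : List ℤˣ} (hI : I ≠ []) :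
    ∃! v, IsFormalPeriodic a b I v := by
  have ha : 0 < a := by have := abs_nonneg b; linarith
  have hpos : 0 < I.length := List.length_pos_iff.2 hI
  have hinj : Function.Injective
      (linIter a b I - LinearMap.id : ℝ × ℝ →ₗ[ℝ] ℝ × ℝ) := by
    rw [← LinearMap.ker_eq_bot, LinearMap.ker_eq_bot']
    intro v hv
    have hv' : linIter a b I v = v := by simpa [sub_eq_zero] using hv
    have hd : formalIter a b I v = v + formalIter a b I 0 := by
      rw [formalIter_eq_linIter_add, hv']
    have := max_principle (p := I.length) (K := 0) (B := 0)
      (w := fun k => orbitSeq a b I v k - orbitSeq a b I 0 k) hab (by simp)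
      (orbitSeq_sub_le ha I v 0)
      (Or.inr ⟨I.length - 1, by omega, by
        simp only [Nat.sub_add_cancel hpos, orbitSeq_length, hd]
        simp [orbitSeq]⟩)
      (Or.inr ⟨0, hpos, by
        simp only [orbitSeq_length_succ, hd]
        simp [orbitSeq, formalIter]⟩)
    have h0 := this 0 (by omega)
    have h1 := this 1 (by omega)
    simp [orbitSeq, formalIter] at h0 h1
    ext <;> simp [h0, h1]
  obtain ⟨v, hv⟩ := LinearMap.injective_iff_surjective.1 hinj (-formalIter a b I 0)
  have hiff : ∀ u, IsFormalPeriodic a b I u ↔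
      (linIter a b I - LinearMap.id : ℝ × ℝ →ₗ[ℝ] ℝ × ℝ) u = -formalIter a b I 0 := by
    intro u
    rw [IsFormalPeriodic, formalIter_eq_linIter_add, LinearMap.sub_apply, LinearMap.id_apply,
      sub_eq_iff_eq_add, eq_comm, ← eq_sub_iff_add_eq, neg_add_eq_sub]
  exact ⟨v, (hiff v).2 hv, fun u hu => hinj (((hiff u).1 hu).trans hv.symm)⟩

theorem orbitSeq_abs_le_one {a b : ℝ} (hb : 0 ≤ b) (hab : 1 + b < a) {I : List ℤˣ} (hI : I ≠ [])
    {v : ℝ × ℝ} (hv : IsFormalPeriodic a b I v) : ∀ k ≤ I.length + 1, |orbitSeq a b I v k| ≤ 1 := by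
  have hpos : 0 < I.length := List.length_pos_iff.2 hI
  refine max_principle (a := a) (b := b) (K := a - b - 1) (by rwa [abs_of_nonneg hb])
    (by rw [abs_of_nonneg hb]; linarith) ?_
    (Or.inr ⟨I.length - 1, by omega, ?_⟩) (Or.inr ⟨0, hpos, orbitSeq_one_eq_of_periodic hv⟩)
  · intro k hk
    exact abs_rec_le (by linarith) (abs_sgn _) (by rw [abs_of_pos]; linarith)
      (orbitSeq_rec a b I v hk)
  · rw [Nat.sub_add_cancel hpos]; exact orbitSeq_zero_eq_of_periodic hv

/-! ### The orbit through the critical locus -/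

/-- Otherwise the homogeneous recursion would have a solution vanishing at both ends, hence
identically zero, whereas its value at index `1` is `1`. -/
theorem linIter_fst_ne_zero {a b : ℝ} (hab : 1 + |b| < a) (J : List ℤˣ) :
    (linIter a b J (1, 0)).1 ≠ 0 := by
  intro h
  have ha : 0 < a := by have := abs_nonneg b; linarith
  have := max_principle (p := J.length) (K := 0) (B := 0)
    (w := fun k => orbitSeq a b J (1, 0) k - orbitSeq a b J 0 k) hab (by simp)
    (orbitSeq_sub_le ha J (1, 0) 0) (Or.inl (by simp [orbitSeq]))
    (Or.inl (by
      simp only [orbitSeq_length_succ, formalIter_eq_linIter_add a b J (1, 0)]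
      simp [h]))
  have h1 := this 1 (by omega)
  norm_num [orbitSeq, formalIter] at h1

/-- The number `x` such that the formal orbit of `(x, 0)` along `J` ends on `x = 0`. -/
noncomputable def critStart (a b : ℝ) (J : List ℤˣ) : ℝ :=
  -(formalIter a b J 0).1 / (linIter a b J (1, 0)).1

theorem formalIter_critStart {a b : ℝ} (hab : 1 + |b| < a) (J : List ℤˣ) :
    (formalIter a b J (critStart a b J, 0)).1 = 0 := by
  have h := linIter_fst_ne_zero hab J
  have h2 : (critStart a b J, (0 : ℝ)) = critStart a b J • ((1 : ℝ), (0 : ℝ)) := by simp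
  rw [formalIter_eq_linIter_add, h2, map_smul]
  simp only [Prod.fst_add, Prod.smul_fst, smul_eq_mul, critStart]
  field_simp
  ring

/-- The signed distance between the image of the endpoint of the critical orbit along `J` and its
starting point. -/
noncomputable def gap (a b : ℝ) (J : List ℤˣ) : ℝ :=
  (a - b - 1) - b * (formalIter a b J (critStart a b J, 0)).2 - critStart a b J

/-- The orbit sequence of the critical orbit. -/
noncomputable def critSeq (a b : ℝ) (J : List ℤˣ) : ℕ → ℝ :=
  orbitSeq a b J (critStart a b J, 0)

theorem critSeq_zero (a b : ℝ) (J : List ℤˣ) : critSeq a b J 0 = 0 := rfl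

theorem critSeq_last {a b : ℝ} (hab : 1 + |b| < a) (J : List ℤˣ) :
    critSeq a b J (J.length + 1) = 0 := by
  rw [critSeq, orbitSeq_length_succ, formalIter_critStart hab]

theorem gap_eq (a b : ℝ) (J : List ℤˣ) :
    gap a b J = (a - b - 1) - b * critSeq a b J J.length - critSeq a b J 1 := by
  rw [critSeq, orbitSeq_length]; rfl

theorem critSeq_abs_le {a b B : ℝ} (hab : 1 + |b| < a) (J : List ℤˣ)
    (hB : |a - b - 1| ≤ (a - 1 - |b|) * B) : ∀ k ≤ J.length + 1, |critSeq a b J k| ≤ B := by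
  have hB0 : 0 ≤ B := by
    by_contra! h
    have := abs_nonneg (a - b - 1)
    nlinarith
  refine max_principle hab hB ?_ (Or.inl (by simpa [critSeq_zero] using hB0))
    (Or.inl (by simpa [critSeq_last hab] using hB0))
  intro k hk
  exact abs_rec_le (by have := abs_nonneg b; linarith) (abs_sgn _) le_rfl (orbitSeq_rec a b J _ hk)

/-! ### Comparison of a periodic orbit with the critical orbit. -/

/-- A branch copies the first coordinate into the second, so the last coordinate `t` of the periodic
orbit equals `θ.2`. The critical sequence is `0` at both ends, so the difference is `t` at both ends
and the maximum principle applies. -/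
theorem periodic_sub_critSeq {a b : ℝ} (hab : 1 + |b| < a) {J : List ℤˣ} {σ : ℤˣ} {θ : ℝ × ℝ}
    (hθ : IsFormalPeriodic a b (J ++ [σ]) θ) :
    ∀ k ≤ J.length + 1,
      |orbitSeq a b J θ k - critSeq a b J k| ≤ |(formalIter a b J θ).1| := by
  have ha : 0 < a := by have := abs_nonneg b; linarith
  have h2 : θ.2 = (formalIter a b J θ).1 := by
    conv_lhs => rw [hθ, formalIter_append]
    rfl
  refine max_principle (K := 0) hab (mul_nonneg (by linarith) (abs_nonneg _))
    (orbitSeq_sub_le ha J _ _) (Or.inl ?_) (Or.inl ?_)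
  · change |θ.2 - 0| ≤ _
    rw [← h2, sub_zero]
  · rw [critSeq_last hab J, orbitSeq_length_succ, sub_zero]

/-- Since `a > 1 + |b|`, this forces `gap` and `sgn σ * t` to have the same sign, where `t` is the
last coordinate. It is the link between the gap and admissibility. -/
theorem gap_sub_le {a b : ℝ} (hab : 1 + |b| < a) {J : List ℤˣ} {σ : ℤˣ} {θ : ℝ × ℝ}
    (hθ : IsFormalPeriodic a b (J ++ [σ]) θ) :
    |gap a b J - sgn σ * a * (formalIter a b J θ).1| ≤
      (1 + |b|) * |(formalIter a b J θ).1| := by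
  have h1 := periodic_sub_critSeq hab hθ 1 (by omega)
  have h2 := periodic_sub_critSeq hab hθ J.length (by omega)
  have h3 : θ.1 = -(sgn σ) * a * (formalIter a b J θ).1 - b * orbitSeq a b J θ J.length
      + (a - b - 1) := by
    conv_lhs => rw [hθ, formalIter_append]
    rw [orbitSeq_length]; rfl
  have h4 : orbitSeq a b J θ 1 = θ.1 := by simp [orbitSeq, formalIter]
  rw [h4] at h1
  have : gap a b J - sgn σ * a * (formalIter a b J θ).1 =
      (θ.1 - critSeq a b J 1) + b * (orbitSeq a b J θ J.length - critSeq a b J J.length) := by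
    rw [gap_eq, h3]; ring
  rw [this]
  calc _ ≤ |θ.1 - critSeq a b J 1| +
          |b| * |orbitSeq a b J θ J.length - critSeq a b J J.length| := by
        rw [← abs_mul]; exact abs_add_le _ _
    _ ≤ |(formalIter a b J θ).1| + |b| * |(formalIter a b J θ).1| := by gcongr
    _ = _ := by ring

theorem sgn_mul_nonneg_of_gap_nonneg {a b : ℝ} (hab : 1 + |b| < a) {J : List ℤˣ} {σ : ℤˣ}
    {θ : ℝ × ℝ} (hθ : IsFormalPeriodic a b (J ++ [σ]) θ) (h : 0 ≤ gap a b J) :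
    0 ≤ sgn σ * (formalIter a b J θ).1 := by
  have h1 := (abs_le.1 (gap_sub_le hab hθ)).2
  set t := (formalIter a b J θ).1
  by_contra! hneg
  have h2 : |t| = -(sgn σ * t) := by
    rw [← abs_of_neg hneg, abs_mul, abs_sgn, one_mul]
  rw [h2] at h1
  nlinarith

theorem sgn_mul_neg_of_gap_neg {a b : ℝ} (hab : 1 + |b| < a) {J : List ℤˣ} {σ : ℤˣ}
    {θ : ℝ × ℝ} (hθ : IsFormalPeriodic a b (J ++ [σ]) θ) (h : gap a b J < 0) :
    sgn σ * (formalIter a b J θ).1 < 0 := by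
  have h1 := (abs_le.1 (gap_sub_le hab hθ)).1
  set t := (formalIter a b J θ).1
  by_contra! hneg
  have h2 : |t| = sgn σ * t := by
    rw [← abs_of_nonneg hneg, abs_mul, abs_sgn, one_mul]
  rw [h2] at h1
  nlinarith

theorem formalIter_fst_ne_zero_of_gap_pos {a b : ℝ} (hab : 1 + |b| < a) {J : List ℤˣ} {σ : ℤˣ}
    {θ : ℝ × ℝ} (hθ : IsFormalPeriodic a b (J ++ [σ]) θ) (h : 0 < gap a b J) :
    (formalIter a b J θ).1 ≠ 0 := by
  intro h0
  have h1 := (abs_le.1 (gap_sub_le hab hθ)).2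
  rw [h0] at h1
  simp at h1
  linarith

theorem formalIter_fst_eq_zero_of_gap_eq_zero {a b : ℝ} (hab : 1 + |b| < a) {J : List ℤˣ} {σ : ℤˣ}
    {θ : ℝ × ℝ} (hθ : IsFormalPeriodic a b (J ++ [σ]) θ) (h : gap a b J = 0) :
    (formalIter a b J θ).1 = 0 := by
  have h1 := gap_sub_le hab hθ
  have h3 := abs_nonneg b
  rw [h, zero_sub, abs_neg, abs_mul, abs_mul, abs_sgn, one_mul, abs_of_pos (by linarith)] at h1
  by_contra hne
  nlinarith [abs_pos.2 hne]

theorem eq_critStart_of_gap_eq_zero {a b : ℝ} (hab : 1 + |b| < a) {J : List ℤˣ} {σ : ℤˣ}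
    {θ : ℝ × ℝ} (hθ : IsFormalPeriodic a b (J ++ [σ]) θ) (h : gap a b J = 0) :
    θ = (critStart a b J, 0) := by
  have h0 := periodic_sub_critSeq hab hθ 0 (by omega)
  have h1 := periodic_sub_critSeq hab hθ 1 (by omega)
  rw [formalIter_fst_eq_zero_of_gap_eq_zero hab hθ h] at h0 h1
  simp [critSeq, orbitSeq, formalIter, sub_eq_zero] at h0 h1
  ext <;> simp [h0, h1]

/-! ### Analytic dependence -/

theorem half_le_fderiv_of_expanding {F : ℝ × ℝ → ℝ} {b a₀ s t : ℝ} (ha₀ : a₀ ∈ Ioo s t)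
    (hF : DifferentiableAt ℝ F (b, a₀))
    (hmono : ∀ a₁ a₂, s ≤ a₁ → a₁ < a₂ → a₂ ≤ t → (a₂ - a₁) / 2 ≤ F (b, a₂) - F (b, a₁)) :
    1 / 2 ≤ fderiv ℝ F (b, a₀) (0, 1) := by
  have hg : HasDerivAt (fun a => F (b, a)) (fderiv ℝ F (b, a₀) (0, 1)) a₀ := by
    have h1 : HasDerivAt (fun a : ℝ => (b, a)) ((0 : ℝ), (1 : ℝ)) a₀ :=
      (hasDerivAt_const a₀ b).prodMk (hasDerivAt_id a₀)
    exact hF.hasFDerivAt.comp_hasDerivAt a₀ h1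
  refine ge_of_tendsto hg.tendsto_slope ?_
  filter_upwards [self_mem_nhdsWithin, mem_nhdsWithin_of_mem_nhds (Ioo_mem_nhds ha₀.1 ha₀.2)]
    with y hy hyI
  rw [slope_def_field]
  rcases lt_or_gt_of_ne (show y ≠ a₀ from hy) with h | h
  · have := hmono y a₀ hyI.1.le h ha₀.2.le
    rw [le_div_iff_of_neg (by linarith)]
    linarith
  · have := hmono a₀ y ha₀.1.le h hyI.2.le
    rw [le_div_iff₀ (by linarith)]
    linarith

/-- The intermediate value theorem gives a zero for each `b`, and expansion in `a` makes it unique.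
Expansion also bounds the partial derivative below by `1 / 2`, so the zero agrees locally with an
analytic implicit function. -/
theorem exists_analytic_zero {F : ℝ × ℝ → ℝ} {s t δ : ℝ} (hst : s ≤ t)
    (hF : ∀ b a, |b| < δ → a ∈ Icc s t → AnalyticAt ℝ F (b, a))
    (hmono : ∀ b, |b| < δ → ∀ a₁ a₂, s ≤ a₁ → a₁ < a₂ → a₂ ≤ t →
      (a₂ - a₁) / 2 ≤ F (b, a₂) - F (b, a₁))
    (hs : ∀ b, |b| < δ → F (b, s) < 0) (ht : ∀ b, |b| < δ → 0 < F (b, t)) :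
    ∃ l : ℝ → ℝ, ∀ b, |b| < δ → AnalyticAt ℝ l b ∧ l b ∈ Ioo s t ∧ F (b, l b) = 0 := by
  have hex : ∀ b, ∃ a, |b| < δ → a ∈ Ioo s t ∧ F (b, a) = 0 := by
    intro b
    by_cases hb : |b| < δ
    · have hc : ContinuousOn (fun a => F (b, a)) (Icc s t) := fun a ha =>
        ((hF b a hb ha).continuousAt.comp
          (f := fun a : ℝ => (b, a)) (by fun_prop)).continuousWithinAt
      obtain ⟨a, ha, h0⟩ := intermediate_value_Ioo hst hc ⟨hs b hb, ht b hb⟩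
      exact ⟨a, fun _ => ⟨ha, h0⟩⟩
    · exact ⟨0, fun h => absurd h hb⟩
  choose l hl using hex
  refine ⟨l, fun b hb => ⟨?_, hl b hb⟩⟩
  obtain ⟨hmem, hzero⟩ := hl b hb
  have han := hF b (l b) hb (Ioo_subset_Icc_self hmem)
  have cdf : ContDiffAt ℝ (⊤ : WithTop ℕ∞) F (b, l b) := han.contDiffAt
  have hne : fderiv ℝ F (b, l b) (0, 1) ≠ 0 := by
    have := half_le_fderiv_of_expanding hmem han.differentiableAt (hmono b hb)
    intro h
    linarith
  have hinv : (fderiv ℝ F (b, l b) ∘L .inr ℝ ℝ ℝ).IsInvertible := by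
    refine ⟨ContinuousLinearEquiv.unitsEquivAut ℝ (Units.mk0 _ hne), ?_⟩
    ext
    simp
  have pn : (⊤ : WithTop ℕ∞) ≠ 0 := by simp
  have h1 := cdf.eventually_apply_implicitFunction pn hinv
  have h2 := cdf.contDiffAt_implicitFunction pn hinv
  have h3 := cdf.implicitFunction_apply_self pn hinv
  set ψ := cdf.implicitFunction pn hinv
  have h4 : ∀ᶠ x in 𝓝 b, ψ x ∈ Ioo s t := by
    refine h2.continuousAt.eventually (Ioo_mem_nhds ?_ ?_)
    · exact h3.symm ▸ hmem.1
    · exact h3.symm ▸ hmem.2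
  have h5 : ∀ᶠ x in 𝓝 b, |x| < δ := continuousAt_id.abs.eventually_lt continuousAt_const hb
  -- `ψ x` and `l x` are zeros in the same interval; if they differed, expansion would separate the
  -- values of `F`.
  refine AnalyticAt.congr h2.analyticAt ?_
  filter_upwards [h1, h4, h5] with x hx1 hx2 hx3
  obtain ⟨hm, hz⟩ := hl x hx3
  rw [hzero] at hx1
  rcases lt_trichotomy (ψ x) (l x) with h | h | h
  · have := hmono x hx3 _ _ hx2.1.le h hm.2.le
    linarith
  · exact h
  · have := hmono x hx3 _ _ hm.1.le h hx2.2.le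
    linarith

theorem analyticAt_formalIter {E : Type*} [NormedAddCommGroup E] [NormedSpace ℝ E]
    {f g : E → ℝ} {x : E} (hf : AnalyticAt ℝ f x) (hg : AnalyticAt ℝ g x) (I : List ℤˣ)
    {v : E → ℝ × ℝ} (hv : AnalyticAt ℝ v x) :
    AnalyticAt ℝ (fun q => formalIter (f q) (g q) I (v q)) x := by
  induction I generalizing v with
  | nil => exact hv
  | cons σ I ih =>
    simp only [formalIter_cons]
    refine ih ?_
    unfold branch
    have h1 : AnalyticAt ℝ (fun q => (v q).1) x := analyticAt_fst.comp hv
    have h2 : AnalyticAt ℝ (fun q => (v q).2) x := analyticAt_snd.comp hv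
    fun_prop

theorem linIter_eq_sub (a b : ℝ) (I : List ℤˣ) (v : ℝ × ℝ) :
    linIter a b I v = formalIter a b I v - formalIter a b I 0 := by
  rw [formalIter_eq_linIter_add, add_sub_cancel_right]

theorem analyticAt_gap {a b : ℝ} (hab : 1 + |b| < a) (J : List ℤˣ) :
    AnalyticAt ℝ (fun q : ℝ × ℝ => gap q.2 q.1 J) (b, a) := by
  have hfst : AnalyticAt ℝ (fun q : ℝ × ℝ => q.1) (b, a) := analyticAt_fst
  have hsnd : AnalyticAt ℝ (fun q : ℝ × ℝ => q.2) (b, a) := analyticAt_snd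
  have h0 := analyticAt_formalIter hsnd hfst J (v := fun _ => 0) analyticAt_const
  have h1 := analyticAt_formalIter hsnd hfst J (v := fun _ => (1, 0)) analyticAt_const
  have hc : AnalyticAt ℝ (fun q : ℝ × ℝ => critStart q.2 q.1 J) (b, a) := by
    unfold critStart
    refine AnalyticAt.div (analyticAt_fst.comp h0).neg ?_ (linIter_fst_ne_zero hab J)
    simp only [linIter_eq_sub]
    exact analyticAt_fst.comp (h1.sub h0)
  have h2 := analyticAt_formalIter hsnd hfst J
    (v := fun q => (critStart q.2 q.1 J, 0)) (hc.prod analyticAt_const)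
  have h3 : AnalyticAt ℝ
      (fun q : ℝ × ℝ => (formalIter q.2 q.1 J (critStart q.2 q.1 J, 0)).2) (b, a) :=
    analyticAt_snd.comp h2
  unfold gap
  fun_prop

theorem mul_abs_of_pos {a : ℝ} (ha : 0 < a) (x : ℝ) : a * |x| = |a * x| := by
  rw [abs_mul, abs_of_pos ha]

/-! ### The recursion along the itinerary `ι` -/

theorem iotaStem_length {m n : ℕ} (hm : 2 ≤ m) (hn : 2 ≤ n) :
    (iotaStem m n).length = m + n - 1 := by
  simp [iotaStem]; omega

theorem iotaStem_getElem {m n : ℕ} (hm : 2 ≤ m) {k : ℕ} (hk : k < (iotaStem m n).length) :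
    (iotaStem m n)[k] = if k = 0 ∨ k = m - 1 ∨ k = m then 1 else -1 := by
  simp only [iotaStem, List.getElem_append, List.getElem_replicate]
  simp only [List.length_append, List.length_replicate, List.length_cons, List.length_nil]
  split_ifs <;> first | omega | rfl | skip
  all_goals grind

/-- The recursion satisfied by the orbits along `iotaStem m n`. -/
structure IsStemSeq (a b : ℝ) (m n : ℕ) (w : ℕ → ℝ) : Prop where
  plus : ∀ k, k = 0 ∨ k = m - 1 ∨ k = m → w (k + 2) = -a * w (k + 1) - b * w k + (a - b - 1)
  minus : ∀ k, k < m + n - 1 → k ≠ 0 → k ≠ m - 1 → k ≠ m →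
    w (k + 2) = a * w (k + 1) - b * w k + (a - b - 1)

theorem isStemSeq_orbitSeq (a b : ℝ) {m n : ℕ} (hm : 2 ≤ m) (hn : 2 ≤ n) (J : List ℤˣ)
    (v : ℝ × ℝ) : IsStemSeq a b m n (orbitSeq a b (iotaStem m n ++ J) v) := by
  have hl := iotaStem_length hm hn
  have key : ∀ k, k < m + n - 1 → orbitSeq a b (iotaStem m n ++ J) v (k + 2) =
      -(sgn (if k = 0 ∨ k = m - 1 ∨ k = m then 1 else -1)) * a *
        orbitSeq a b (iotaStem m n ++ J) v (k + 1)
      - b * orbitSeq a b (iotaStem m n ++ J) v k + (a - b - 1) := by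
    intro k hk
    have hk' : k < (iotaStem m n).length := by omega
    rw [orbitSeq_rec a b _ v (k := k) (by rw [List.length_append]; omega),
      List.getElem_append_left hk', iotaStem_getElem hm]
  constructor
  · intro k hk
    rw [key k (by omega), if_pos hk, sgn_one]
    ring
  · intro k hk h0 h1 h2
    rw [key k hk, if_neg (by tauto), sgn_neg_one]
    ring

theorem isStemSeq_critSeq (a b : ℝ) {m n : ℕ} (hm : 2 ≤ m) (hn : 2 ≤ n) :
    IsStemSeq a b m n (critSeq a b (iotaStem m n)) := by
  have h := isStemSeq_orbitSeq a b hm hn [] (critStart a b (iotaStem m n), 0)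
  rwa [List.append_nil] at h

namespace IsStemSeq

variable {a b B : ℝ} {m n : ℕ} {w : ℕ → ℝ}

/-- The value `-1` is fixed by the minus recursion, so solving backwards contracts `w + 1` by `1 / a
≤ 2 / 3`. Each step adds at most `(2 / 3) (B + 1) |b|`, and the geometric series sums to `2 (B + 1)
|b|`. -/
theorem abs_add_one_le (h : IsStemSeq a b m n w) (ha : 3 / 2 ≤ a) (hn : 2 ≤ n)
    (hB : ∀ k ≤ m + n, |w k| ≤ B) :
    ∀ j ≤ m - 2, |w (m - j) + 1| ≤ (B + 1) * (2 / 3) ^ j + 2 * (B + 1) * |b| := by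
  have hB1 : ∀ k ≤ m + n, |w k + 1| ≤ B + 1 := fun k hk =>
    (_root_.abs_add_le _ _).trans (by simpa using hB k hk)
  have hB0 : 0 ≤ B := (abs_nonneg _).trans (hB 0 (by omega))
  intro j
  induction j with
  | zero =>
    intro _
    have := hB1 m (by omega)
    simp only [pow_zero, Nat.sub_zero]
    nlinarith [abs_nonneg b]
  | succ j ih =>
    intro hj
    have hr := h.minus (m - j - 2) (by omega) (by omega) (by omega) (by omega)
    rw [show m - j - 2 + 2 = m - j by omega, show m - j - 2 + 1 = m - (j + 1) by omega] at hr
    have h1 : a * (w (m - (j + 1)) + 1) = (w (m - j) + 1) + b * (w (m - j - 2) + 1) := by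
      rw [hr]; ring
    have h2 : a * |w (m - (j + 1)) + 1| ≤ |w (m - j) + 1| + |b| * |w (m - j - 2) + 1| := by
      rw [← abs_mul b, mul_abs_of_pos (by linarith), h1]
      exact _root_.abs_add_le _ _
    have h3 := ih (by omega)
    have h4 := mul_le_mul_of_nonneg_left (hB1 (m - j - 2) (by omega)) (abs_nonneg b)
    have h5 : 3 / 2 * |w (m - (j + 1)) + 1| ≤ a * |w (m - (j + 1)) + 1| := by gcongr
    rw [pow_succ]
    nlinarith

theorem abs_two_le (h : IsStemSeq a b m n w) (ha : 3 / 2 ≤ a) (hm : 2 ≤ m) (hn : 2 ≤ n)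
    (hB : ∀ k ≤ m + n, |w k| ≤ B) :
    |w 2 + 1| ≤ (B + 1) * ((2 / 3) ^ (m - 2) + 2 * |b|) := by
  have := h.abs_add_one_le ha hn hB (m - 2) le_rfl
  rw [show m - (m - 2) = 2 by omega] at this
  linarith

/-- Together with `abs_two_le` this places `w 1` near `1`. -/
theorem mul_one_sub (h : IsStemSeq a b m n w) :
    a * (1 - w 1) = (w 2 + 1) + b * (w 0 + 1) := by
  have := h.plus 0 (by simp)
  simp only [zero_add] at this
  rw [this]; ring

/-- Negative signs propagate backwards along the second block of minus signs. -/
theorem neg_second (h : IsStemSeq a b m n w) (ha : 1 < a) (hb : 0 ≤ b) (hc : b < a - b - 1)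
    (hB : ∀ k ≤ m + n, |w k| ≤ 1) (hl : w (m + n) < a - b - 1 - b) :
    ∀ i, m + 2 ≤ i → i < m + n → w i < 0 := by
  -- The weak bound is what propagates, since the last value need not be negative; one backward step
  -- turns it into negativity, which implies it again because `b < a - b - 1`.
  have key : ∀ j, m + 2 ≤ m + n - j →
      w (m + n - j) < a - b - 1 - b ∧ (1 ≤ j → w (m + n - j) < 0) := by
    intro j
    induction j with
    | zero => intro _; exact ⟨hl, by omega⟩
    | succ j ih =>
      intro hj
      have h1 := (ih (by omega)).1
      have hr := h.minus (m + n - j - 2) (by omega) (by omega) (by omega) (by omega)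
      rw [show m + n - j - 2 + 2 = m + n - j by omega,
        show m + n - j - 2 + 1 = m + n - (j + 1) by omega] at hr
      have h2 := (abs_le.1 (hB (m + n - j - 2) (by omega))).2
      have h3 : w (m + n - (j + 1)) < 0 := by
        have : a * w (m + n - (j + 1)) < 0 := by nlinarith
        by_contra! hcon
        nlinarith
      exact ⟨by linarith, fun _ => h3⟩
  intro i hi hi2
  have := (key (m + n - i) (by omega)).2 (by omega)
  rwa [show m + n - (m + n - i) = i by omega] at this

/-- Negative signs propagate backwards along the first block of minus signs. -/
theorem neg_first (h : IsStemSeq a b m n w) (ha : 1 < a) (hb : 0 ≤ b) (hc : b < a - b - 1)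
    (hB : ∀ k ≤ m + n, |w k| ≤ 1) (hl : w m < a - b - 1 - b) :
    ∀ i, 2 ≤ i → i < m → w i < 0 := by
  have key : ∀ j, 2 ≤ m - j → w (m - j) < a - b - 1 - b ∧ (1 ≤ j → w (m - j) < 0) := by
    intro j
    induction j with
    | zero => intro _; exact ⟨hl, by omega⟩
    | succ j ih =>
      intro hj
      have h1 := (ih (by omega)).1
      have hr := h.minus (m - j - 2) (by omega) (by omega) (by omega) (by omega)
      rw [show m - j - 2 + 2 = m - j by omega,
        show m - j - 2 + 1 = m - (j + 1) by omega] at hr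
      have h2 := (abs_le.1 (hB (m - j - 2) (by omega))).2
      have h3 : w (m - (j + 1)) < 0 := by
        have : a * w (m - (j + 1)) < 0 := by nlinarith
        by_contra! hcon
        nlinarith
      exact ⟨by linarith, fun _ => h3⟩
  intro i hi hi2
  have := (key (m - i) (by omega)).2 (by omega)
  rwa [show m - (m - i) = i by omega] at this

theorem pos_middle (h : IsStemSeq a b m n w) (ha : 1 < a) (hb : 0 ≤ b)
    (hB : ∀ k ≤ m + n, |w k| ≤ 1) (hl : w (m + 2) < a - b - 1 - b) : 0 < w (m + 1) := by
  have hr := h.plus m (by simp)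
  have h2 := (abs_le.1 (hB m (by omega))).2
  have : 0 < a * w (m + 1) := by nlinarith
  exact (mul_pos_iff_of_pos_left (by linarith)).1 this

theorem mul_le_of_pos_middle (h : IsStemSeq a b m n w) (hm : 2 ≤ m) (hb : 0 ≤ b)
    (hB : ∀ k ≤ m + n, |w k| ≤ 1) (hl : 0 < w (m + 1)) : a * w m ≤ a - 1 := by
  have hr := h.plus (m - 1) (by simp)
  rw [show m - 1 + 2 = m + 1 by omega, show m - 1 + 1 = m by omega] at hr
  have h2 := (abs_le.1 (hB (m - 1) (by omega))).1
  nlinarith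

end IsStemSeq

/-! ### The sign of the gap -/

section gap

variable {a b : ℝ} {m n : ℕ}

theorem one_add_abs_lt (ha : 3 / 2 ≤ a) (hb : |b| ≤ 1 / 200) : 1 + |b| < a := by linarith

/-- Negative `b` is allowed, so that the curve is analytic in a full neighbourhood of `b = 0`; this
is why the bound is `2` instead of `1`. -/
theorem critSeq_abs_le_two (ha : 3 / 2 ≤ a) (hb : |b| ≤ 1 / 200) (J : List ℤˣ) :
    ∀ k ≤ J.length + 1, |critSeq a b J k| ≤ 2 := by
  refine critSeq_abs_le (one_add_abs_lt ha hb) J ?_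
  have h1 := abs_le.1 hb
  have h2 := le_abs_self b
  have h3 := neg_abs_le b
  rw [abs_le]
  constructor <;> linarith

theorem critSeq_abs_le_one (hb : 0 ≤ b) (hab : 1 + b < a) (J : List ℤˣ) :
    ∀ k ≤ J.length + 1, |critSeq a b J k| ≤ 1 := by
  refine critSeq_abs_le (by rwa [abs_of_nonneg hb]) J ?_
  rw [abs_of_nonneg hb, abs_of_pos] <;> linarith

theorem abs_one_sub_critSeq_le (ha : 3 / 2 ≤ a) (hb : |b| ≤ 1 / 200) (hm : 2 ≤ m) (hn : 2 ≤ n) :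
    |1 - critSeq a b (iotaStem m n) 1| ≤ 2 * (2 / 3) ^ (m - 2) + 5 * |b| := by
  have hs := isStemSeq_critSeq a b hm hn
  have hl := iotaStem_length hm hn
  have h2 := hs.abs_two_le ha hm hn (B := 2)
    fun k hk => critSeq_abs_le_two ha hb _ k (by omega)
  have h3 := hs.mul_one_sub
  rw [critSeq_zero, zero_add, mul_one] at h3
  have h4 : a * |1 - critSeq a b (iotaStem m n) 1| ≤
      |critSeq a b (iotaStem m n) 2 + 1| + |b| := by
    rw [mul_abs_of_pos (by linarith), h3]
    exact abs_add_le _ _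
  have h5 := mul_le_mul_of_nonneg_right ha (abs_nonneg (1 - critSeq a b (iotaStem m n) 1))
  linarith [abs_nonneg b]

/-- Here `critSeq 1` is near `1` and `b` is small, so the gap is about `a - 2 = -1 / 2`. -/
theorem gap_neg_left (hb : |b| ≤ 1 / 200) (hm : 2 ≤ m) (hn : 2 ≤ n)
    (hq : (2 / 3 : ℝ) ^ (m - 2) ≤ 1 / 100) : gap (3 / 2) b (iotaStem m n) < 0 := by
  have h1 := (abs_le.1 (abs_one_sub_critSeq_le (a := 3 / 2) le_rfl hb hm hn)).2
  have h2 := critSeq_abs_le_two (a := 3 / 2) le_rfl hb (iotaStem m n) (iotaStem m n).length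
    (by omega)
  have h3 : |b * critSeq (3 / 2) b (iotaStem m n) (iotaStem m n).length| ≤ 1 / 200 * 2 := by
    rw [abs_mul]; gcongr
  have h4 := (abs_le.1 h3).1
  have h5 := (abs_le.1 hb).1
  rw [gap_eq]
  linarith

theorem gap_pos_right (hb : |b| ≤ 1 / 200) (hm : 2 ≤ m) (hn : 2 ≤ n)
    (hq : (2 / 3 : ℝ) ^ (m - 2) ≤ 1 / 100) : 0 < gap 3 b (iotaStem m n) := by
  have h1 := (abs_le.1 (abs_one_sub_critSeq_le (a := 3) (by norm_num) hb hm hn)).1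
  have h2 := critSeq_abs_le_two (a := 3) (by norm_num) hb (iotaStem m n) (iotaStem m n).length
    (by omega)
  have h3 : |b * critSeq 3 b (iotaStem m n) (iotaStem m n).length| ≤ 1 / 200 * 2 := by
    rw [abs_mul]; gcongr
  have h4 := (abs_le.1 h3).2
  have h5 := (abs_le.1 hb).2
  rw [gap_eq]
  linarith

/-- The gap is expanding in `a`. -/
theorem gap_expanding {a₁ a₂ : ℝ} (h₁ : 3 / 2 ≤ a₁) (h₁₂ : a₁ < a₂) (hb : |b| ≤ 1 / 200)
    (hm : 2 ≤ m) (hn : 2 ≤ n) (hq : (3 * (m : ℝ) + 5) * (2 / 3) ^ (m - 2) ≤ 1 / 4) :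
    (a₂ - a₁) / 2 ≤ gap a₂ b (iotaStem m n) - gap a₁ b (iotaStem m n) := by
  set J := iotaStem m n with hJ
  have hl : J.length = m + n - 1 := iotaStem_length hm hn
  set u := critSeq a₁ b J
  set w := critSeq a₂ b J
  have hu : IsStemSeq a₁ b m n u := isStemSeq_critSeq a₁ b hm hn
  have hw : IsStemSeq a₂ b m n w := isStemSeq_critSeq a₂ b hm hn
  have hub : ∀ k ≤ m + n, |u k| ≤ 2 := fun k hk => critSeq_abs_le_two h₁ hb _ k (by omega)
  set δ := a₂ - a₁ with hδ
  have hδ0 : 0 < δ := by linarith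
  have hab₁ := one_add_abs_lt h₁ hb
  have hab₂ := one_add_abs_lt (h₁.trans h₁₂.le) hb
  -- Crude Lipschitz bound: the change of `a` acts as a forcing of size at most `3 δ`, and `8 (a₂ -
  -- 1 - |b|) ≥ 3`.
  have hΔ : ∀ k ≤ m + n, |w k - u k| ≤ 8 * δ := by
    have := max_principle (p := J.length) (w := fun k => w k - u k) (K := 3 * δ) (B := 8 * δ) hab₂
      (by nlinarith) ?_ (Or.inl (by simp only [u, w, critSeq_zero]; simp; linarith))
      (Or.inl (by simp only [u, w, critSeq_last hab₁, critSeq_last hab₂]; simp; linarith))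
    · intro k hk
      exact this k (by omega)
    · intro k hk
      refine abs_rec_le (e := sgn J[k]) (r := δ * (1 - sgn J[k] * u (k + 1))) (by linarith)
        (abs_sgn _) ?_ ?_
      · rw [abs_mul, abs_of_pos hδ0, mul_comm]
        gcongr
        calc _ ≤ |(1 : ℝ)| + |sgn J[k] * u (k + 1)| := abs_sub _ _
          _ ≤ 1 + 2 := by
            rw [abs_mul, abs_sgn, abs_one, one_mul]
            gcongr
            exact hub _ (by omega)
          _ = 3 := by norm_num
      · simp only [w, u, critSeq]
        rw [orbitSeq_rec a₂ b J _ hk, orbitSeq_rec a₁ b J _ hk, hδ]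
        ring
  -- The forcing `δ |u + 1|` decays at the same rate `2 / 3` as the contraction, whence the linear
  -- factor `8 + 3 j`. The constant `28` is the fixed point of `c ↦ (2 / 3) (c + 8 + 6)`.
  have hchain : ∀ j ≤ m - 2, |w (m - j) - u (m - j)| ≤
      δ * ((8 + 3 * j) * (2 / 3) ^ j + 28 * |b|) := by
    intro j
    induction j with
    | zero =>
      intro _
      have := hΔ m (by omega)
      have h2 : 0 ≤ δ * |b| := by positivity
      simp only [Nat.cast_zero, mul_zero, add_zero, pow_zero, mul_one, Nat.sub_zero]
      linarith
    | succ j ih =>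
      intro hj
      have hr := hu.minus (m - j - 2) (by omega) (by omega) (by omega) (by omega)
      have hr2 := hw.minus (m - j - 2) (by omega) (by omega) (by omega) (by omega)
      rw [show m - j - 2 + 2 = m - j by omega, show m - j - 2 + 1 = m - (j + 1) by omega] at hr hr2
      have h1 : a₂ * (w (m - (j + 1)) - u (m - (j + 1))) = (w (m - j) - u (m - j))
          + b * (w (m - j - 2) - u (m - j - 2)) - δ * (u (m - (j + 1)) + 1) := by
        rw [hr, hr2, hδ]; ring
      have h2 : a₂ * |w (m - (j + 1)) - u (m - (j + 1))| ≤ |w (m - j) - u (m - j)|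
          + |b| * |w (m - j - 2) - u (m - j - 2)| + δ * |u (m - (j + 1)) + 1| := by
        rw [← abs_mul b, mul_abs_of_pos hδ0, mul_abs_of_pos (show 0 < a₂ by linarith), h1]
        refine (abs_sub _ _).trans ?_
        gcongr
        exact abs_add_le _ _
      have h3 := ih (by omega)
      have h4 := mul_le_mul_of_nonneg_left (hΔ (m - j - 2) (by omega)) (abs_nonneg b)
      have h5 := mul_le_mul_of_nonneg_left (hu.abs_add_one_le h₁ hn hub (j + 1) hj) hδ0.le
      have h6 : 3 / 2 * |w (m - (j + 1)) - u (m - (j + 1))| ≤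
        a₂ * |w (m - (j + 1)) - u (m - (j + 1))| := by gcongr; linarith
      have h7 : 0 ≤ δ * (2 / 3) ^ j := by positivity
      rw [pow_succ] at h5 ⊢
      push_cast
      have h8 : 0 ≤ |b| * δ := by positivity
      nlinarith
  have hD2 := hchain (m - 2) le_rfl
  rw [show m - (m - 2) = 2 by omega, Nat.cast_sub hm] at hD2
  push_cast at hD2
  have hU := abs_one_sub_critSeq_le (m := m) (n := n) h₁ hb hm hn
  have hrow : a₂ * (w 1 - u 1) = δ * (1 - u 1) - (w 2 - u 2) := by
    have e1 := hu.plus 0 (by simp)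
    have e2 := hw.plus 0 (by simp)
    have e3 : u 0 = 0 := rfl
    have e4 : w 0 = 0 := rfl
    simp only [zero_add, e3, e4] at e1 e2
    rw [e1, e2, hδ]; ring
  have hq0 : 0 ≤ (2 / 3 : ℝ) ^ (m - 2) := by positivity
  set q := (2 / 3 : ℝ) ^ (m - 2)
  have hm' : (2 : ℝ) ≤ m := by exact_mod_cast hm
  have h1 : a₂ * (w 1 - u 1) ≤ δ * (2 * q + 5 * |b|) + δ * ((8 + 3 * (m - 2)) * q + 28 * |b|) := by
    rw [hrow]
    have := mul_le_mul_of_nonneg_left (abs_le.1 hU).2 hδ0.le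
    have := (abs_le.1 hD2).1
    linarith
  -- The first coordinate moves by less than `9 / 20` of `δ`, and the term with `b` below costs at
  -- most `1 / 25`, so more than half of `δ` remains.
  have h2 : w 1 - u 1 ≤ δ * (9 / 20) := by
    by_contra! hcon
    have e1 : (2 * q + 5 * |b|) + ((8 + 3 * ((m : ℝ) - 2)) * q + 28 * |b|) ≤ 1 / 4 + 33 / 200 := by
      nlinarith
    have e2 := mul_le_mul_of_nonneg_left e1 hδ0.le
    nlinarith
  have h3 : |b * (w J.length - u J.length)| ≤ 1 / 200 * (8 * δ) := by
    rw [abs_mul]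
    gcongr
    exact hΔ _ (by omega)
  have h4 := (abs_le.1 h3).2
  have h5 : gap a₂ b J - gap a₁ b J = δ - b * (w J.length - u J.length) - (w 1 - u 1) := by
    rw [gap_eq, gap_eq, hδ]; ring
  rw [h5]
  linarith

/-- The gap is negative for parameters with small expansion. -/
theorem gap_neg_of_le (hb0 : 0 ≤ b) (hb : b ≤ 1 / 200) (hab : 3 * b + 1 < a) (ha : a ≤ 3 / 2)
    (hm : 12 ≤ m) (hn : 2 ≤ n) : gap a b (iotaStem m n) < 0 := by
  set J := iotaStem m n with hJ
  have hl : J.length = m + n - 1 := iotaStem_length (by omega) hn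
  set w := critSeq a b J
  have hw : IsStemSeq a b m n w := isStemSeq_critSeq a b (by omega) hn
  have hB : ∀ k ≤ m + n, |w k| ≤ 1 := fun k hk =>
    critSeq_abs_le_one hb0 (by linarith) _ k (by omega)
  have hX0 : ∀ k ≤ m + n, 0 ≤ w k + 1 := fun k hk => by linarith [(abs_le.1 (hB k hk)).1]
  have hX2 : ∀ k ≤ m + n, w k + 1 ≤ 2 := fun k hk => by linarith [(abs_le.1 (hB k hk)).2]
  have hlast : w (m + n) = 0 := by
    have := critSeq_last (a := a) (b := b) (by rw [abs_of_nonneg hb0]; linarith) J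
    rwa [hl, show m + n - 1 + 1 = m + n by omega] at this
  have hm2 : w (m + 2) < a - b - 1 - b := by
    rcases Nat.lt_or_ge 2 n with h | h
    · have := hw.neg_second (by linarith) hb0 (by linarith) hB (by rw [hlast]; linarith) (m + 2)
        le_rfl (by omega)
      linarith
    · rw [show m + 2 = m + n by omega, hlast]; linarith
  have hmid := hw.pos_middle (by linarith) hb0 hB hm2
  have hm0 := hw.mul_le_of_pos_middle (by omega) hb0 hB hmid
  set s := a - 1 with hs
  have ha' : a = 1 + s := by rw [hs]; ring
  have hXm : w m + 1 ≤ 1 + s := by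
    by_contra! hcon
    nlinarith
  have hrow1 : a * (w 2 + 1) = (w 3 + 1) + b * (w 1 + 1) := by
    have := hw.minus 1 (by omega) (by omega) (by omega) (by omega)
    simp only [Nat.reduceAdd] at this
    rw [this]; ring
  have hrow0 : a * (1 - w 1) = (w 2 + 1) + b := by
    have := hw.mul_one_sub
    rwa [show w 0 = 0 from rfl, zero_add, mul_one] at this
  have hgap : gap a b J ≤ s - w 1 := by
    have := (abs_le.1 (hB J.length (by omega))).1
    rw [gap_eq]
    nlinarith
  -- By `hgap` it is enough that `s < w 1`; multiplied by `a = 1 + s`, this is a bound on `w 2 + 1`.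
  suffices hsuff : (w 2 + 1) + b < (1 + s) * (1 - s) by
    have : a * (s - w 1) < 0 := by rw [ha'] at hrow0 ⊢; nlinarith
    have : s - w 1 < 0 := by
      by_contra! hcon
      nlinarith
    linarith
  have hb1 : b * (w 1 + 1) ≤ b * 2 := mul_le_mul_of_nonneg_left (hX2 1 (by omega)) hb0
  -- If `w 2 ≤ w 3`, then `w + 1` grows at least by the factor `a - b` along the whole block, while
  -- it is at most `1 + s` at index `m`, so `w 3 + 1` is small. Otherwise one step of the recursion
  -- already bounds `w 2 + 1`.
  rcases le_or_gt (w 2) (w 3) with h23 | h23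
  · have hgrow : ∀ j, j + 3 ≤ m →
        w (j + 2) ≤ w (j + 3) ∧ (a - b) ^ j * (w 3 + 1) ≤ w (j + 3) + 1 := by
      intro j
      induction j with
      | zero => intro _; exact ⟨h23, by simp⟩
      | succ j ih =>
        intro hj
        obtain ⟨i1, i2⟩ := ih (by omega)
        have hr := hw.minus (j + 2) (by omega) (by omega) (by omega) (by omega)
        have e1 : w (j + 1 + 3) + 1 = a * (w (j + 3) + 1) - b * (w (j + 2) + 1) := by
          rw [show j + 1 + 3 = j + 2 + 2 by omega, hr]; ring
        have e2 : (a - b) * (w (j + 3) + 1) ≤ w (j + 1 + 3) + 1 := by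
          rw [e1]; nlinarith
        have e3 := hX0 (j + 3) (by omega)
        constructor
        · rw [show j + 1 + 2 = j + 3 by omega]
          nlinarith
        · rw [pow_succ]
          nlinarith
    have h1 := (hgrow (m - 3) (by omega)).2
    rw [show m - 3 + 3 = m by omega] at h1
    -- Bernoulli with `m - 3 ≥ 9`; since `3 b < s`, the left side is at least `1 + 6 s`.
    have h2 : 1 + 9 * (s - b) ≤ (a - b) ^ (m - 3) := by
      have hbern := one_add_mul_le_pow (a := s - b) (by linarith) (m - 3)
      have : (9 : ℝ) ≤ ((m - 3 : ℕ) : ℝ) := by exact_mod_cast (by omega : 9 ≤ m - 3)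
      rw [show a - b = 1 + (s - b) by rw [ha']; ring]
      nlinarith
    have h3 : (1 + 6 * s) * (w 3 + 1) ≤ 1 + s := by
      have h3' := hX0 3 (by omega)
      have : (1 + 6 * s) ≤ (a - b) ^ (m - 3) := by linarith
      nlinarith
    have hs0 : 0 ≤ s := by linarith
    have hs1 : s ≤ 1 / 2 := by linarith
    -- The cubic is what the goal needs: `(1 + s) (w 2 + 1 + b)` is at most `w 3 + 1 + 3 b + b s`,
    -- with `3 b < s` and `b s ≤ s ^ 2 / 3`, against `(1 + s) ^ 2 (1 - s)`.
    have h4 : 1 + s ≤ (1 + 6 * s) * (1 - 4 / 3 * s ^ 2 - s ^ 3) := by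
      have : 0 ≤ s * (5 - 4 / 3 * s - 9 * s ^ 2 - 6 * s ^ 3) := by
        refine mul_nonneg hs0 ?_
        nlinarith [pow_le_pow_left₀ hs0 hs1 2, pow_le_pow_left₀ hs0 hs1 3]
      nlinarith
    have h5 : w 3 + 1 ≤ 1 - 4 / 3 * s ^ 2 - s ^ 3 := by
      by_contra! hcon
      nlinarith
    have h6 : (1 + s) * ((w 2 + 1) + b) < (1 + s) * ((1 + s) * (1 - s)) := by
      have : b * s ≤ s / 3 * s := by gcongr; linarith
      rw [ha'] at hrow1
      nlinarith
    exact lt_of_mul_lt_mul_left h6 (by linarith)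
  · have h1 : s * (w 2 + 1) ≤ 2 * b := by
      rw [ha'] at hrow1
      linarith
    have hs0 : 0 < s := by linarith
    have h2 : w 2 + 1 ≤ 2 / 3 := by
      by_contra! hcon
      have := mul_lt_mul_of_pos_left hcon hs0
      linarith
    have h3 : s * s ≤ 1 / 2 * (1 / 2) := by gcongr <;> linarith
    linarith

/-- A nonnegative gap forces `a` to be almost `2`. -/
theorem mul_two_sub_le_of_gap_nonneg (ha : 3 / 2 ≤ a) (hb0 : 0 ≤ b) (hb : b ≤ 1 / 200)
    (hm : 2 ≤ m) (hn : 2 ≤ n) (h : 0 ≤ gap a b (iotaStem m n)) :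
    a * (2 - a) ≤ 2 * (2 / 3) ^ (m - 2) + 5 * b := by
  set J := iotaStem m n with hJ
  have hl : J.length = m + n - 1 := iotaStem_length (by omega) hn
  set w := critSeq a b J
  have hw : IsStemSeq a b m n w := isStemSeq_critSeq a b (by omega) hn
  have hB : ∀ k ≤ m + n, |w k| ≤ 1 := fun k hk =>
    critSeq_abs_le_one hb0 (by linarith) _ k (by omega)
  have h2 := (abs_le.1 (hw.abs_two_le ha hm hn hB)).2
  rw [abs_of_nonneg hb0] at h2
  have h3 := hw.mul_one_sub
  rw [show w 0 = 0 from rfl, zero_add, mul_one] at h3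
  rw [gap_eq] at h
  have h4 := (abs_le.1 (hB J.length (by omega))).1
  have h5 : w 1 ≤ a - 1 := by nlinarith
  nlinarith

end gap

/-! ### Admissibility -/

theorem iota_length {m n : ℕ} (σ : ℤˣ) (hm : 2 ≤ m) (hn : 2 ≤ n) :
    (iota σ m n).length = m + n := by
  rw [iota, List.length_append, iotaStem_length hm hn, List.length_singleton]; omega

theorem iota_getElem {m n : ℕ} {σ : ℤˣ} (hm : 2 ≤ m) (hn : 2 ≤ n) {k : ℕ}
    (hk : k < (iota σ m n).length) :
    (iota σ m n)[k] = if k = m + n - 1 then σ else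
      if k = 0 ∨ k = m - 1 ∨ k = m then 1 else -1 := by
  have hl := iotaStem_length hm hn
  have hl2 := iota_length σ hm hn
  split_ifs with h1 h2
  all_goals simp only [iota, List.getElem_append, hl]
  · simp [h1]
  · rw [dif_pos (by omega), iotaStem_getElem hm, if_pos h2]
  · rw [dif_pos (by omega), iotaStem_getElem hm, if_neg h2]

/-- The strict signs along the orbit of a formal periodic point, all but the last. -/
structure HasIotaSigns (m n : ℕ) (w : ℕ → ℝ) : Prop where
  first : 0 < w 1
  block₁ : ∀ i, 2 ≤ i → i < m → w i < 0
  middle : 0 < w m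
  middle' : 0 < w (m + 1)
  block₂ : ∀ i, m + 2 ≤ i → i < m + n → w i < 0

section

variable {a b : ℝ} {m n : ℕ} {σ : ℤˣ} {θ : ℝ × ℝ}

theorem orbitSeq_iota_last (hm : 2 ≤ m) (hn : 2 ≤ n) :
    orbitSeq a b (iota σ m n) θ (m + n) = (formalIter a b (iotaStem m n) θ).1 := by
  have hl := iotaStem_length hm hn
  rw [iota, orbitSeq_append _ _ _ _ _ (by omega), show m + n = (iotaStem m n).length + 1 by omega,
    orbitSeq_length_succ]

/-- The signs are found by solving backwards from the last coordinate. Only positivity of `w m`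
needs the arithmetic condition `hH`: it requires `w (m + 1)` to stay below the image of the critical
locus. -/
theorem hasIotaSigns_of_periodic (ha : 3 / 2 ≤ a) (hb0 : 0 ≤ b) (hb : b ≤ 1 / 400) (hm : 3 ≤ m)
    (hn : 2 ≤ n) (hq : (2 / 3 : ℝ) ^ (m - 2) ≤ 1 / 100)
    (hH : 3 ≤ a ∨ a * (2 - a) + 2 * a * b < (1 / 3) ^ (n - 1))
    (hθ : IsFormalPeriodic a b (iota σ m n) θ)
    (hσ : 0 ≤ sgn σ * (formalIter a b (iotaStem m n) θ).1) :
    HasIotaSigns m n (orbitSeq a b (iota σ m n) θ) := by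
  rw [← orbitSeq_iota_last (σ := σ) (by omega) hn] at hσ
  have hl := iota_length σ (show 2 ≤ m by omega) hn
  set w := orbitSeq a b (iota σ m n) θ with hw_def
  have hw : IsStemSeq a b m n w := isStemSeq_orbitSeq a b (by omega) hn [σ] θ
  have hB' := orbitSeq_abs_le_one hb0 (by linarith) (List.ne_nil_of_length_pos (by omega)) hθ
  rw [hl] at hB'
  have hB : ∀ k ≤ m + n, |w k| ≤ 1 := fun k hk => hB' k (by omega)
  have hX0 : ∀ k ≤ m + n, 0 ≤ w k + 1 := fun k hk => by linarith [(abs_le.1 (hB k hk)).1]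
  have hlast : w 1 = -(sgn σ) * a * w (m + n) - b * w (m + n - 1) + (a - b - 1) := by
    have h1 := orbitSeq_one_eq_of_periodic hθ
    rw [hl] at h1
    have h2 := orbitSeq_rec a b (iota σ m n) θ (k := m + n - 1) (by omega)
    rw [show m + n - 1 + 2 = m + n + 1 by omega, show m + n - 1 + 1 = m + n by omega, h1,
      iota_getElem (by omega) hn, if_pos rfl] at h2
    exact h2
  have h2 := (abs_le.1 (hw.abs_two_le ha (by omega) hn hB)).2
  rw [abs_of_nonneg hb0] at h2
  have h3 := hw.mul_one_sub
  have h4 := (abs_le.1 (hB 0 (by omega))).2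
  have h5 := abs_le.1 (hB (m + n - 1) (by omega))
  have hw1 : 9 / 10 ≤ w 1 := by
    by_contra! hcon
    nlinarith
  -- For `σ = -1`, closing the orbit reads `w 1 + 1 = a (w (m + n) + 1) - b (w (m + n - 1) + 1)`,
  -- and `w 1` is near `1`.
  have hX : 1 / 3 ≤ w (m + n) + 1 ∨ 3 ≤ a := by
    rcases le_or_gt 3 a with h | h
    · exact Or.inr h
    left
    rcases Int.units_eq_one_or σ with rfl | rfl
    · rw [sgn_one] at hσ
      linarith
    · rw [sgn_neg_one] at hlast
      by_contra! hcon
      nlinarith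
  have ht : w (m + n) < a - b - 1 - b := by
    rcases Int.units_eq_one_or σ with rfl | rfl
    · rw [sgn_one] at hlast
      by_contra! hcon
      nlinarith
    · rw [sgn_neg_one] at hσ
      linarith
  have hblock₂ := hw.neg_second (by linarith) hb0 (by linarith) hB ht
  have hm2 : w (m + 2) < a - b - 1 - b := by
    rcases Nat.lt_or_ge 2 n with h | h
    · linarith [hblock₂ (m + 2) le_rfl (by omega)]
    · rwa [show m + 2 = m + n by omega]
  have hmid' := hw.pos_middle (by linarith) hb0 hB hm2
  have hmm := hw.mul_le_of_pos_middle (by omega) hb0 hB hmid'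
  have hm0 : w m < a - b - 1 - b := by
    by_contra! hcon
    nlinarith
  have hblock₁ := hw.neg_first (by linarith) hb0 (by linarith) hB hm0
  have hm1 : w (m + 1) < a - b - 1 - b := by
    rcases le_or_gt 3 a with h | h
    · linarith [(abs_le.1 (hB (m + 1) (by omega))).2]
    have hH' := hH.resolve_left (by linarith)
    have hX' := hX.resolve_right (by linarith)
    -- For `a < 3` each backward minus step shrinks `w + 1` at most by the factor `1 / 3`. At `j = n
    -- - 2` this gives `w (m + 2) + 1 ≥ (1 / 3) ^ (n - 1)`, the quantity in `hH`.
    have hchain : ∀ j ≤ n - 2, (1 / 3 : ℝ) ^ (j + 1) ≤ w (m + n - j) + 1 := by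
      intro j
      induction j with
      | zero => intro _; simpa using hX'
      | succ j ih =>
        intro hj
        have i1 := ih (by omega)
        have hr := hw.minus (m + n - j - 2) (by omega) (by omega) (by omega) (by omega)
        rw [show m + n - j - 2 + 2 = m + n - j by omega,
          show m + n - j - 2 + 1 = m + n - (j + 1) by omega] at hr
        have i2 := mul_nonneg hb0 (hX0 (m + n - j - 2) (by omega))
        have i3 := hX0 (m + n - (j + 1)) (by omega)
        rw [pow_succ]
        nlinarith
    have h6 := hchain (n - 2) le_rfl
    rw [show n - 2 + 1 = n - 1 by omega, show m + n - (n - 2) = m + 2 by omega] at h6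
    have h7 := hw.plus m (by simp)
    have h8 := mul_nonneg hb0 (hX0 m (by omega))
    by_contra! hcon
    nlinarith
  refine ⟨by linarith, hblock₁, ?_, hmid', hblock₂⟩
  have hr := hw.plus (m - 1) (by simp)
  rw [show m - 1 + 2 = m + 1 by omega, show m - 1 + 1 = m by omega] at hr
  have h9 := (abs_le.1 (hB (m - 1) (by omega))).2
  by_contra! hcon
  nlinarith

theorem HasIotaSigns.sign_pos (hm : 3 ≤ m) (hn : 2 ≤ n)
    (h : HasIotaSigns m n (orbitSeq a b (iota σ m n) θ)) {k : ℕ} (hk : k < m + n - 1) :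
    0 < sgn ((iota σ m n)[k]'(by rw [iota_length σ (by omega) hn]; omega)) *
      orbitSeq a b (iota σ m n) θ (k + 1) := by
  rw [iota_getElem (by omega) hn, if_neg (by omega)]
  split_ifs with h1
  · rw [sgn_one, one_mul]
    rcases h1 with rfl | rfl | rfl
    · exact h.first
    · rw [show m - 1 + 1 = m by omega]; exact h.middle
    · exact h.middle'
  · rw [sgn_neg_one, neg_one_mul, neg_pos]
    rcases Nat.lt_or_ge k m with h2 | h2
    · exact h.block₁ _ (by omega) (by omega)
    · exact h.block₂ _ (by omega) (by omega)

theorem HasIotaSigns.isAdmissible (hm : 3 ≤ m) (hn : 2 ≤ n)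
    (h : HasIotaSigns m n (orbitSeq a b (iota σ m n) θ))
    (hσ : 0 ≤ sgn σ * (formalIter a b (iotaStem m n) θ).1) :
    IsAdmissible a b (iota σ m n) θ := by
  intro k hk
  rw [iota_length σ (by omega) hn] at hk
  change 0 ≤ _ * orbitSeq a b (iota σ m n) θ (k + 1)
  rcases Nat.lt_or_ge k (m + n - 1) with h1 | h1
  · exact (h.sign_pos hm hn h1).le
  · obtain rfl : k = m + n - 1 := by omega
    rw [iota_getElem (by omega) hn, if_pos rfl, show m + n - 1 + 1 = m + n by omega,
      orbitSeq_iota_last (by omega) hn]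
    exact hσ

/-! ### From formal orbits to orbits of the Lozi map. -/

theorem map_eq_branch {v : ℝ × ℝ} (h : 0 ≤ sgn σ * v.1) : map a b v = branch a b σ v := by
  rcases Int.units_eq_one_or σ with rfl | rfl
  · rw [sgn_one, one_mul] at h
    simp [map, branch, sgn_one, abs_of_nonneg h]
  · rw [sgn_neg_one, neg_one_mul, neg_nonneg] at h
    simp [map, branch, sgn_neg_one, abs_of_nonpos h]

theorem IsAdmissible.iterate_eq {I : List ℤˣ} (h : IsAdmissible a b I θ) :
    ∀ k ≤ I.length, (map a b)^[k] θ = formalIter a b (I.take k) θ := by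
  intro k
  induction k with
  | zero => intro _; rfl
  | succ k ih =>
    intro hk
    rw [Function.iterate_succ_apply', ih (by omega), formalIter_take_succ a b I θ hk]
    exact map_eq_branch (h k hk)

theorem IsAdmissible.iterate_last (hm : 2 ≤ m) (hn : 2 ≤ n)
    (h : IsAdmissible a b (iota σ m n) θ) :
    (map a b)^[m + n - 1] θ = formalIter a b (iotaStem m n) θ := by
  have hl := iotaStem_length hm hn
  rw [h.iterate_eq (m + n - 1) (by rw [iota_length σ hm hn]; omega), iota, ← hl, List.take_left]

theorem isHyperbolic_of_hasIotaSigns (hm : 3 ≤ m) (hn : 2 ≤ n)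
    (hθ : IsFormalPeriodic a b (iota σ m n) θ)
    (h : HasIotaSigns m n (orbitSeq a b (iota σ m n) θ))
    (hσ : 0 ≤ sgn σ * (formalIter a b (iotaStem m n) θ).1)
    (hne : (formalIter a b (iotaStem m n) θ).1 ≠ 0) : IsHyperbolic a b (iota σ m n) θ := by
  have had := h.isAdmissible hm hn hσ
  refine ⟨hθ, had, fun k hk => ?_⟩
  rw [had.iterate_eq k hk.le]
  rw [iota_length σ (by omega) hn] at hk
  change orbitSeq a b (iota σ m n) θ (k + 1) ≠ 0
  rcases Nat.lt_or_ge k (m + n - 1) with h1 | h1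
  · exact right_ne_zero_of_mul (h.sign_pos hm hn h1).ne'
  · rw [show k + 1 = m + n by omega, orbitSeq_iota_last (by omega) hn]
    exact hne

end

/-! ### Vertical lines and their pullbacks -/

/-- The line `x = slope * y + icpt`. -/
structure Line where
  /-- The slope with respect to the vertical direction. -/
  slope : ℝ
  /-- The intercept with the axis `y = 0`. -/
  icpt : ℝ

namespace Line

/-- The first coordinate of the point of the line at height `y`. -/
def val (l : Line) (y : ℝ) : ℝ := l.slope * y + l.icpt

/-- The vertical segment of the line in the strip. -/
def seg (l : Line) : Set (ℝ × ℝ) := {v | v ∈ strip ∧ v.1 = l.val v.2}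

/-- The line is steep and crosses the square `[-1, 1]²` from bottom to top. -/
def Crosses (l : Line) : Prop := |l.slope| ≤ 1 / 2 ∧ |l.slope| + |l.icpt| ≤ 1

/-- Weak order of the segments in the strip. -/
def LeftOf (l l' : Line) : Prop := ∀ y ∈ Icc (-1 : ℝ) 1, l.val y ≤ l'.val y

/-- Strict order of the segments in the strip. -/
def StrictLeftOf (l l' : Line) : Prop := ∀ y ∈ Icc (-1 : ℝ) 1, l.val y < l'.val y

theorem StrictLeftOf.leftOf {l l' : Line} (h : l.StrictLeftOf l') : l.LeftOf l' :=
  fun y hy => (h y hy).le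

/-- The line mapped to `l` by a branch. -/
noncomputable def pull (a b : ℝ) (σ : ℤˣ) (l : Line) : Line :=
  ⟨-b / (sgn σ * a + l.slope), (a - b - 1 - l.icpt) / (sgn σ * a + l.slope)⟩

theorem Crosses.val_mem {l : Line} (hl : l.Crosses) {y : ℝ} (hy : y ∈ Icc (-1 : ℝ) 1) :
    l.val y ∈ Icc (-1 : ℝ) 1 := by
  rw [mem_Icc, ← abs_le] at hy ⊢
  calc |l.val y| ≤ |l.slope * y| + |l.icpt| := abs_add_le _ _
    _ ≤ |l.slope| * 1 + |l.icpt| := by rw [abs_mul]; gcongr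
    _ ≤ 1 := by rw [mul_one]; exact hl.2

end Line

/-- The closed region between two lines in the strip. -/
def lineRegion (l l' : Line) : Set (ℝ × ℝ) :=
  {v | v ∈ strip ∧ l.val v.2 ≤ v.1 ∧ v.1 ≤ l'.val v.2}

theorem between_seg {l l' : Line} (h : l.LeftOf l') : between l.seg l'.seg = lineRegion l l' := by
  ext v
  constructor
  · rintro ⟨hv, x₁, x₂, ⟨_, h1⟩, ⟨_, h2⟩, h3⟩
    simp only at h1 h2
    rw [h1, h2, uIcc_of_le (h _ hv)] at h3
    exact ⟨hv, h3.1, h3.2⟩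
  · rintro ⟨hv, h1, h2⟩
    refine ⟨hv, l.val v.2, l'.val v.2, ⟨hv, rfl⟩, ⟨hv, rfl⟩, ?_⟩
    rw [uIcc_of_le (h _ hv)]
    exact ⟨h1, h2⟩

theorem isVerticalSegment_seg (l : Line) : IsVerticalSegment l.seg := by
  refine ⟨l.slope, l.icpt, ?_⟩
  ext v
  simp only [Line.seg, Line.val, mem_inter_iff, mem_ofPred_eq]
  tauto

theorem isVerticalStrip_lineRegion {l l' : Line} (h : l.StrictLeftOf l') :
    IsVerticalStrip (lineRegion l l') := by
  refine ⟨l.seg, l'.seg, isVerticalSegment_seg l, isVerticalSegment_seg l', ?_,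
    (between_seg h.leftOf).symm⟩
  rw [Set.disjoint_left]
  rintro v ⟨⟨hv, h1⟩, _⟩ ⟨⟨_, h2⟩, _⟩
  have := h v.2 hv
  linarith

/-- Parameters with strong expansion and small Jacobian. -/
structure Expanding (a b : ℝ) : Prop where
  le_a : 19 / 10 ≤ a
  nonneg : 0 ≤ b
  b_le : b ≤ 1 / 400

section pull

variable {a b : ℝ} {l l' : Line}

open Line

theorem Line.Crosses.pos_den (hl : l.Crosses) (h : Expanding a b) : 0 < a + l.slope := by
  have := (abs_le.1 hl.1).1
  linarith [h.le_a]

theorem Line.Crosses.neg_den (hl : l.Crosses) (h : Expanding a b) : -a + l.slope < 0 := by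
  have := (abs_le.1 hl.1).2
  linarith [h.le_a]

theorem Line.Crosses.den_ne_zero (hl : l.Crosses) (h : Expanding a b) (σ : ℤˣ) :
    sgn σ * a + l.slope ≠ 0 := by
  rcases Int.units_eq_one_or σ with rfl | rfl
  · rw [sgn_one, one_mul]; exact (hl.pos_den h).ne'
  · rw [sgn_neg_one, neg_one_mul]; exact (hl.neg_den h).ne

/-- A branch multiplies the horizontal offset from a line by a constant. For crossing lines the
constant is negative for `Λ_+` and positive for `Λ_-`, so pulling back by `+` reverses the
left-right order and pulling back by `-` keeps it. -/
theorem branch_sub_val (h : Expanding a b) (hl : l.Crosses) (σ : ℤˣ) (v : ℝ × ℝ) :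
    (branch a b σ v).1 - l.val (branch a b σ v).2 =
      -(sgn σ * a + l.slope) * (v.1 - (pull a b σ l).val v.2) := by
  have := hl.den_ne_zero h σ
  simp only [branch, Line.val, pull]
  field_simp
  ring

theorem Line.Crosses.pull (h : Expanding a b) (hl : l.Crosses) (σ : ℤˣ) :
    (pull a b σ l).Crosses := by
  have h1 : a - |l.slope| ≤ |sgn σ * a + l.slope| := by
    have h2 := abs_sub_abs_le_abs_sub (sgn σ * a) (-l.slope)
    rw [abs_mul, abs_sgn, one_mul, abs_neg, sub_neg_eq_add,
      abs_of_nonneg (by linarith [h.le_a])] at h2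
    exact h2
  have h2 := hl.1
  have h3 := h.le_a
  have h4 := h.nonneg
  have h5 := h.b_le
  have h6 : 0 < |sgn σ * a + l.slope| := by linarith
  have h7 : b + |a - b - 1 - l.icpt| ≤ a - |l.slope| := by
    have := abs_le.1 (show |l.icpt| ≤ 1 - |l.slope| by linarith [hl.2])
    rcases abs_cases (a - b - 1 - l.icpt) with ⟨e, _⟩ | ⟨e, _⟩ <;> rw [e] <;> linarith
  constructor
  · simp only [Line.pull, abs_div, abs_neg, abs_of_nonneg h4]
    rw [div_le_iff₀ h6]
    linarith
  · simp only [Line.pull, abs_div, abs_neg, abs_of_nonneg h4]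
    rw [← add_div, div_le_one h6]
    linarith

theorem branch_one_le_iff (h : Expanding a b) (hl : l.Crosses) {v : ℝ × ℝ} :
    (branch a b 1 v).1 ≤ l.val (branch a b 1 v).2 ↔ (pull a b 1 l).val v.2 ≤ v.1 := by
  have h1 := branch_sub_val h hl 1 v
  have h2 := hl.pos_den h
  rw [sgn_one, one_mul] at h1
  constructor <;> intro h3
  · by_contra! hcon
    nlinarith
  · nlinarith

theorem le_branch_one_iff (h : Expanding a b) (hl : l.Crosses) {v : ℝ × ℝ} :
    l.val (branch a b 1 v).2 ≤ (branch a b 1 v).1 ↔ v.1 ≤ (pull a b 1 l).val v.2 := by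
  have h1 := branch_sub_val h hl 1 v
  have h2 := hl.pos_den h
  rw [sgn_one, one_mul] at h1
  constructor <;> intro h3
  · by_contra! hcon
    nlinarith
  · nlinarith

theorem branch_neg_one_le_iff (h : Expanding a b) (hl : l.Crosses) {v : ℝ × ℝ} :
    (branch a b (-1) v).1 ≤ l.val (branch a b (-1) v).2 ↔ v.1 ≤ (pull a b (-1) l).val v.2 := by
  have h1 := branch_sub_val h hl (-1) v
  have h2 := hl.neg_den h
  rw [sgn_neg_one, neg_one_mul] at h1
  constructor <;> intro h3
  · by_contra! hcon
    nlinarith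
  · nlinarith

theorem le_branch_neg_one_iff (h : Expanding a b) (hl : l.Crosses) {v : ℝ × ℝ} :
    l.val (branch a b (-1) v).2 ≤ (branch a b (-1) v).1 ↔ (pull a b (-1) l).val v.2 ≤ v.1 := by
  have h1 := branch_sub_val h hl (-1) v
  have h2 := hl.neg_den h
  rw [sgn_neg_one, neg_one_mul] at h1
  constructor <;> intro h3
  · by_contra! hcon
    nlinarith
  · nlinarith

/-- The point of a pulled back line is mapped to the line. -/
theorem branch_pull_val (h : Expanding a b) (hl : l.Crosses) (σ : ℤˣ) (y : ℝ) :
    (branch a b σ ((pull a b σ l).val y, y)).1 = l.val ((pull a b σ l).val y) := by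
  have := branch_sub_val h hl σ ((pull a b σ l).val y, y)
  simp only [sub_self, mul_zero] at this
  exact sub_eq_zero.1 this

theorem Line.LeftOf.pull_one (h : Expanding a b) (hl : l.Crosses) (hl' : l'.Crosses)
    (hll : l.LeftOf l') : (pull a b 1 l').LeftOf (pull a b 1 l) := by
  intro y hy
  have h1 := hll _ ((hl.pull h 1).val_mem hy)
  rw [← branch_pull_val h hl 1 y] at h1
  exact (branch_one_le_iff h hl' (v := ((Line.pull a b 1 l).val y, y))).1 h1

theorem Line.LeftOf.pull_neg_one (h : Expanding a b) (hl : l.Crosses) (hl' : l'.Crosses)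
    (hll : l.LeftOf l') : (pull a b (-1) l).LeftOf (pull a b (-1) l') := by
  intro y hy
  have h1 := hll _ ((hl.pull h (-1)).val_mem hy)
  rw [← branch_pull_val h hl (-1) y] at h1
  exact (branch_neg_one_le_iff h hl' (v := ((Line.pull a b (-1) l).val y, y))).1 h1

theorem Line.StrictLeftOf.pull_one (h : Expanding a b) (hl : l.Crosses) (hl' : l'.Crosses)
    (hll : l.StrictLeftOf l') : (pull a b 1 l').StrictLeftOf (pull a b 1 l) := by
  intro y hy
  have h1 := hll _ ((hl.pull h 1).val_mem hy)
  rw [← branch_pull_val h hl 1 y] at h1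
  exact not_le.1 fun hcon =>
    h1.not_ge ((le_branch_one_iff h hl' (v := ((Line.pull a b 1 l).val y, y))).2 hcon)

theorem Line.StrictLeftOf.pull_neg_one (h : Expanding a b) (hl : l.Crosses) (hl' : l'.Crosses)
    (hll : l.StrictLeftOf l') : (pull a b (-1) l).StrictLeftOf (pull a b (-1) l') := by
  intro y hy
  have h1 := hll _ ((hl.pull h (-1)).val_mem hy)
  rw [← branch_pull_val h hl (-1) y] at h1
  exact not_le.1 fun hcon =>
    h1.not_ge ((le_branch_neg_one_iff h hl' (v := ((Line.pull a b (-1) l).val y, y))).2 hcon)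

theorem pullback_seg (h : Expanding a b) (hl : l.Crosses) (σ : ℤˣ) :
    pullback a b σ l.seg = (pull a b σ l).seg := by
  ext v
  have h1 := branch_sub_val h hl σ v
  constructor
  · rintro ⟨⟨_, h2⟩, hv⟩
    refine ⟨hv, ?_⟩
    rw [h2, sub_self, eq_comm, mul_eq_zero, neg_eq_zero] at h1
    linarith [h1.resolve_left (hl.den_ne_zero h σ)]
  · rintro ⟨hv, h2⟩
    refine ⟨⟨?_, ?_⟩, hv⟩
    · change v.1 ∈ Icc (-1 : ℝ) 1
      rw [h2]
      exact (hl.pull h σ).val_mem hv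
    · rw [h2, sub_self, mul_zero] at h1
      linarith

theorem Line.Crosses.iterate_pull (h : Expanding a b) (hl : l.Crosses) (k : ℕ) :
    ((Line.pull a b (-1))^[k] l).Crosses := by
  induction k with
  | zero => exact hl
  | succ k ih => rw [Function.iterate_succ_apply']; exact ih.pull h _

theorem Line.LeftOf.iterate_pull (h : Expanding a b) (hl : l.Crosses) (hl' : l'.Crosses)
    (hll : l.LeftOf l') (k : ℕ) :
    ((Line.pull a b (-1))^[k] l).LeftOf ((Line.pull a b (-1))^[k] l') := by
  induction k with
  | zero => exact hll
  | succ k ih =>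
    rw [Function.iterate_succ_apply', Function.iterate_succ_apply']
    exact ih.pull_neg_one h (hl.iterate_pull h k) (hl'.iterate_pull h k)

theorem Line.StrictLeftOf.iterate_pull (h : Expanding a b) (hl : l.Crosses) (hl' : l'.Crosses)
    (hll : l.StrictLeftOf l') (k : ℕ) :
    ((Line.pull a b (-1))^[k] l).StrictLeftOf ((Line.pull a b (-1))^[k] l') := by
  induction k with
  | zero => exact hll
  | succ k ih =>
    rw [Function.iterate_succ_apply', Function.iterate_succ_apply']
    exact ih.pull_neg_one h (hl.iterate_pull h k) (hl'.iterate_pull h k)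

theorem formalIter_replicate_le_iff (h : Expanding a b) (hl : l.Crosses) (k : ℕ) {v : ℝ × ℝ} :
    (formalIter a b (List.replicate k (-1)) v).1 ≤
      l.val (formalIter a b (List.replicate k (-1)) v).2 ↔
      v.1 ≤ ((pull a b (-1))^[k] l).val v.2 := by
  induction k generalizing v with
  | zero => rfl
  | succ k ih =>
    rw [List.replicate_succ, formalIter_cons, ih, Function.iterate_succ_apply',
      branch_neg_one_le_iff h (hl.iterate_pull h k)]

theorem le_formalIter_replicate_iff (h : Expanding a b) (hl : l.Crosses) (k : ℕ) {v : ℝ × ℝ} :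
    l.val (formalIter a b (List.replicate k (-1)) v).2 ≤
      (formalIter a b (List.replicate k (-1)) v).1 ↔
      ((pull a b (-1))^[k] l).val v.2 ≤ v.1 := by
  induction k generalizing v with
  | zero => rfl
  | succ k ih =>
    rw [List.replicate_succ, formalIter_cons, ih, Function.iterate_succ_apply',
      le_branch_neg_one_iff h (hl.iterate_pull h k)]

end pull

/-! ### The local stable manifold of `z_+` -/

/-- The stable eigenvalue at `z_+`. -/
noncomputable def stableEig (a b : ℝ) : ℝ := (-a + √(a ^ 2 - 4 * b)) / 2

/-- The stable line through `z_+`. -/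
noncomputable def stableLine (a b : ℝ) : Line :=
  ⟨stableEig a b, zetaPlus a b * (1 - stableEig a b)⟩

section stable

variable {a b : ℝ}

theorem stableEig_root (h : Expanding a b) :
    stableEig a b * (a + stableEig a b) = -b := by
  have h1 := h.le_a
  have h2 := h.b_le
  have h3 := Real.sq_sqrt (show 0 ≤ a ^ 2 - 4 * b by nlinarith)
  simp only [stableEig]
  nlinarith

theorem half_le_stableEig_den (a b : ℝ) : a / 2 ≤ a + stableEig a b := by
  have := Real.sqrt_nonneg (a ^ 2 - 4 * b)
  simp only [stableEig]
  linarith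

theorem stableEig_nonpos (h : Expanding a b) : stableEig a b ≤ 0 := by
  have h1 := stableEig_root h
  have h2 := half_le_stableEig_den a b
  have h3 := h.le_a
  have h4 := h.nonneg
  by_contra! hcon
  nlinarith

theorem le_stableEig (h : Expanding a b) : -(1 / 100) ≤ stableEig a b := by
  have h1 := stableEig_root h
  have h2 := half_le_stableEig_den a b
  have h3 := h.le_a
  have h4 := h.b_le
  by_contra! hcon
  nlinarith

theorem zetaPlus_mul (h : Expanding a b) : zetaPlus a b * (a + b + 1) = a - b - 1 := by
  have : a + b + 1 ≠ 0 := by linarith [h.le_a, h.nonneg]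
  simp only [zetaPlus]
  field_simp
  ring

theorem zetaPlus_lower (h : Expanding a b) : 3 / 10 ≤ zetaPlus a b := by
  have h1 := zetaPlus_mul h
  have h2 := h.le_a
  have h3 := h.b_le
  have h4 := h.nonneg
  by_contra! hcon
  nlinarith

theorem zetaPlus_lt_one (h : Expanding a b) : zetaPlus a b < 1 := by
  have h1 := zetaPlus_mul h
  have h2 := h.le_a
  have h4 := h.nonneg
  by_contra! hcon
  nlinarith

theorem stableLine_crosses (h : Expanding a b) : (stableLine a b).Crosses := by
  have h1 := stableEig_nonpos h
  have h2 := le_stableEig h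
  have h3 := zetaPlus_lower h
  have h4 := zetaPlus_mul h
  have h5 := stableEig_root h
  have h6 := h.le_a
  have h7 := h.nonneg
  simp only [Line.Crosses, stableLine]
  have h8 : 0 ≤ zetaPlus a b * (1 - stableEig a b) := by nlinarith
  rw [abs_of_nonpos h1, abs_of_nonneg h8]
  refine ⟨by linarith, ?_⟩
  -- By `zetaPlus_mul` and the eigenvalue equation, the right side minus the left side is `2 - 2 λ ^
  -- 2` with `λ = stableEig a b`.
  have h9 : (a + b + 1) * (zetaPlus a b * (1 - stableEig a b)) ≤
      (a + b + 1) * (1 + stableEig a b) := by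
    nlinarith
  have := le_of_mul_le_mul_left h9 (by linarith)
  linarith

theorem stableLine_pos (h : Expanding a b) {y : ℝ} (hy : y ∈ Icc (-1 : ℝ) 1) :
    0 < (stableLine a b).val y := by
  have h1 := stableEig_nonpos h
  have h2 := le_stableEig h
  have h3 := zetaPlus_lower h
  simp only [Line.val, stableLine]
  nlinarith [hy.1, hy.2]

theorem pull_stableLine (h : Expanding a b) : (stableLine a b).pull a b 1 = stableLine a b := by
  have h1 := stableEig_root h
  have h2 := half_le_stableEig_den a b
  have h3 := zetaPlus_mul h
  have h4 : a + stableEig a b ≠ 0 := by linarith [h.le_a]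
  simp only [Line.pull, stableLine, sgn_one, one_mul, Line.mk.injEq]
  constructor
  · rw [div_eq_iff h4, h1]
  · rw [div_eq_iff h4, ← h3]
    linear_combination zetaPlus a b * h1

theorem pull_neg_stableLine_neg (h : Expanding a b) {y : ℝ} (hy : y ∈ Icc (-1 : ℝ) 1) :
    ((stableLine a b).pull a b (-1)).val y < 0 := by
  have h1 := stableEig_nonpos h
  have h2 := le_stableEig h
  have h3 := zetaPlus_lower h
  have h4 := zetaPlus_mul h
  have h5 := (stableLine_crosses h).neg_den h
  have h6 := h.le_a
  have h7 := h.nonneg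
  have h8 := h.b_le
  have h9 : zetaPlus a b * (29 / 10) ≤ a - b - 1 := by nlinarith
  have h10 : ((stableLine a b).pull a b (-1)).val y =
      (-b * y + (a - b - 1 - zetaPlus a b * (1 - stableEig a b))) / (-a + stableEig a b) := by
    simp only [Line.pull, stableLine, Line.val, sgn_neg_one, neg_one_mul]
    ring
  rw [h10]
  refine div_neg_of_pos_of_neg ?_ h5
  nlinarith [hy.1, hy.2]

/-- The linear functional defining the stable direction. -/
noncomputable def stableForm (a b : ℝ) (d : ℝ × ℝ) : ℝ := d.1 - stableEig a b * d.2

/-- The form is a left eigenvector for the unstable eigenvalue. -/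
theorem stableForm_branchLin (h : Expanding a b) (d : ℝ × ℝ) :
    stableForm a b (branchLin a b 1 d) = -(a + stableEig a b) * stableForm a b d := by
  have h1 := stableEig_root h
  simp only [stableForm, branchLin, LinearMap.coe_mk, AddHom.coe_mk, sgn_one]
  linear_combination (-d.2) * h1

theorem branch_add (a b : ℝ) (σ : ℤˣ) (v d : ℝ × ℝ) :
    branch a b σ (v + d) = branch a b σ v + branchLin a b σ d := by
  ext <;> simp [branch, branchLin]; ring

theorem branch_zPlus (h : Expanding a b) : branch a b 1 (zPlus a b) = zPlus a b := by
  have := zetaPlus_mul h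
  simp only [branch, zPlus, sgn_one, Prod.mk.injEq, and_true]
  linarith

theorem map_eq_branch_one {v : ℝ × ℝ} (h : 0 ≤ v.1) : map a b v = branch a b 1 v :=
  map_eq_branch (by rwa [sgn_one, one_mul])

theorem map_eq_branch_neg_one {v : ℝ × ℝ} (h : v.1 ≤ 0) : map a b v = branch a b (-1) v :=
  map_eq_branch (by rw [sgn_neg_one]; linarith)

theorem map_zPlus_add (h : Expanding a b) {d : ℝ × ℝ} (hd : 0 ≤ (zPlus a b + d).1) :
    map a b (zPlus a b + d) = zPlus a b + branchLin a b 1 d := by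
  rw [map_eq_branch_one hd, branch_add, branch_zPlus h]

/-! ### Segments of the stable set through `z_+` lie on the stable line. -/

/-- Points of the stable set eventually land on the stable line. -/
theorem exists_stableForm_eq_zero (h : Expanding a b) {v : ℝ × ℝ}
    (hv : v ∈ stableSet a b (zPlus a b)) :
    ∃ k, stableForm a b ((map a b)^[k] v - zPlus a b) = 0 := by
  have hv' : Tendsto (fun k : ℕ => (map a b)^[k] v) atTop (𝓝 (zPlus a b)) := hv
  have hz : 0 < (zPlus a b).1 := by
    have := zetaPlus_lower h
    simp only [zPlus]; linarith
  have hfst : Tendsto (fun k : ℕ => ((map a b)^[k] v).1) atTop (𝓝 (zPlus a b).1) :=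
    (continuous_fst.tendsto _).comp hv'
  obtain ⟨K, hK⟩ := eventually_atTop.1 (hfst.eventually (lt_mem_nhds hz))
  refine ⟨K, ?_⟩
  have hcont : Continuous fun u : ℝ × ℝ => |stableForm a b (u - zPlus a b)| := by
    unfold stableForm; fun_prop
  have hlim : Tendsto (fun k : ℕ => |stableForm a b ((map a b)^[k] v - zPlus a b)|) atTop
      (𝓝 0) := by
    have := (hcont.tendsto (zPlus a b)).comp hv'
    simp only [stableForm, sub_self, Prod.fst_zero, Prod.snd_zero, mul_zero, abs_zero] at this ⊢
    exact this
  -- Once the orbit stays in `x > 0`, each step multiplies the form by a factor of modulus at least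
  -- `1`, so it can tend to `0` only if it is already `0`.
  have hge : ∀ k ≥ K, |stableForm a b ((map a b)^[K] v - zPlus a b)| ≤
      |stableForm a b ((map a b)^[k] v - zPlus a b)| := by
    intro k hk
    induction k, hk using Nat.le_induction with
    | base => exact le_rfl
    | succ k hk ih =>
      refine ih.trans ?_
      have e1 : (map a b)^[k + 1] v - zPlus a b =
          branchLin a b 1 ((map a b)^[k] v - zPlus a b) := by
        have := map_zPlus_add h (d := (map a b)^[k] v - zPlus a b) (by
          rw [add_sub_cancel]; exact (hK k hk).le)
        rw [add_sub_cancel] at this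
        rw [Function.iterate_succ_apply', this, add_sub_cancel_left]
      rw [e1, stableForm_branchLin h, abs_mul, abs_neg]
      have h1 := le_stableEig h
      have h2 := h.le_a
      rw [abs_of_pos (show 0 < a + stableEig a b by linarith)]
      exact le_mul_of_one_le_left (abs_nonneg _) (by linarith)
  have := ge_of_tendsto hlim (eventually_atTop.2 ⟨K, hge⟩)
  exact abs_nonpos_iff.1 this

/-- A line in an unstable direction meets the preimages of the stable line in countably many
points. -/
theorem countable_stableForm_eq_zero (h : Expanding a b) (k : ℕ) :
    ∀ p d : ℝ × ℝ, |d.2| ≤ |d.1| → d.1 ≠ 0 →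
      {t : ℝ | stableForm a b ((map a b)^[k] (p + t • d) - zPlus a b) = 0}.Countable := by
  have h1 := stableEig_nonpos h
  have h2 := le_stableEig h
  induction k with
  | zero =>
    intro p d hd hd0
    have hne : stableForm a b d ≠ 0 := by
      intro h0
      simp only [stableForm, sub_eq_zero] at h0
      have h3 := abs_pos.2 hd0
      have h4 : |d.1| = -stableEig a b * |d.2| := by rw [h0, abs_mul, abs_of_nonpos h1]
      nlinarith [abs_nonneg d.2]
    refine Set.Subsingleton.countable ?_
    intro t ht s hs
    simp only [mem_ofPred_eq, Function.iterate_zero, id_eq, stableForm, Prod.fst_sub, Prod.fst_add,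
      Prod.snd_sub, Prod.snd_add, Prod.smul_fst, Prod.smul_snd, smul_eq_mul] at ht hs
    have : (t - s) * stableForm a b d = 0 := by
      simp only [stableForm]; linarith
    exact sub_eq_zero.1 ((mul_eq_zero.1 this).resolve_right hne)
  | succ k ih =>
    intro p d hd hd0
    -- The second coordinate of the image is `d.1`, so this is invariance of the unstable cone under
    -- both linear parts.
    have hcone : ∀ σ : ℤˣ, |d.1| ≤ |(branchLin a b σ d).1| := by
      intro σ
      have h3 := abs_sub_abs_le_abs_sub (-(sgn σ) * a * d.1) (b * d.2)
      rw [abs_mul, abs_mul, abs_neg, abs_sgn, abs_mul b, abs_of_nonneg h.nonneg,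
        abs_of_nonneg (show 0 ≤ a by linarith [h.le_a])] at h3
      refine le_trans ?_ h3
      nlinarith [h.le_a, h.nonneg, h.b_le, abs_nonneg d.1, abs_nonneg d.2]
    have hstep : ∀ σ : ℤˣ, {t : ℝ | stableForm a b ((map a b)^[k]
        (branch a b σ p + t • branchLin a b σ d) - zPlus a b) = 0}.Countable := by
      intro σ
      refine ih _ _ (hcone σ) ?_
      have := (abs_pos.2 hd0).trans_le (hcone σ)
      exact abs_pos.1 this
    refine ((hstep 1).union (hstep (-1))).mono ?_
    intro t ht
    simp only [mem_ofPred_eq, Function.iterate_succ_apply] at ht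
    rcases le_total 0 (p + t • d).1 with h0 | h0
    · left
      rwa [map_eq_branch_one h0, branch_add, map_smul] at ht
    · right
      rwa [map_eq_branch_neg_one h0, branch_add, map_smul] at ht

/-- A direction in which the stable set of `z_+` contains a germ of a segment. -/
def HasStableGerm (a b : ℝ) (d : ℝ × ℝ) : Prop :=
  ∃ ε > 0, ∀ t ∈ Icc (0 : ℝ) ε, zPlus a b + t • d ∈ stableSet a b (zPlus a b)

theorem HasStableGerm.branchLin (h : Expanding a b) {d : ℝ × ℝ} (hd : HasStableGerm a b d) :
    HasStableGerm a b (branchLin a b 1 d) := by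
  obtain ⟨ε, hε, hW⟩ := hd
  have hζ := zetaPlus_lower h
  have hpos : 0 < zetaPlus a b / (|d.1| + 1) := by positivity
  refine ⟨min ε (zetaPlus a b / (|d.1| + 1)), lt_min hε hpos, fun t ht => ?_⟩
  have h1 := hW t ⟨ht.1, ht.2.trans (min_le_left _ _)⟩
  have h2 : 0 ≤ (zPlus a b + t • d).1 := by
    have h3 := ht.2.trans (min_le_right _ _)
    rw [le_div_iff₀ (by positivity)] at h3
    have h4 := mul_le_mul_of_nonneg_left (neg_abs_le d.1) ht.1
    simp only [zPlus, Prod.fst_add, Prod.smul_fst, smul_eq_mul]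
    nlinarith [ht.1]
  have h3 := map_zPlus_add h h2
  rw [map_smul] at h3
  rw [← h3]
  have h4 : Tendsto (fun k : ℕ => (map a b)^[k] (zPlus a b + t • d)) atTop (𝓝 (zPlus a b)) := h1
  exact (tendsto_add_atTop_iff_nat 1).2 h4

/-- Off the stable direction the form grows by at least `18 / 10` per step, so the ratio of the
second coordinate to the form falls to about `9 / 10`, while the form and the first coordinate
differ by at most one hundredth of the second. -/
theorem exists_iterate_in_cone (h : Expanding a b) {d : ℝ × ℝ} (hd : stableForm a b d ≠ 0) :
    ∃ j : ℕ, |((branchLin a b 1)^[j] d).2| ≤ |((branchLin a b 1)^[j] d).1| ∧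
      ((branchLin a b 1)^[j] d).1 ≠ 0 := by
  have h1 := stableEig_nonpos h
  have h2 := le_stableEig h
  have h3 := h.le_a
  set r := |d.2| / |stableForm a b d| with hr
  have hr0 : 0 ≤ r := by positivity
  have hlam : |stableEig a b| ≤ 1 / 100 := by rw [abs_of_nonpos h1]; linarith
  have key : ∀ j : ℕ, stableForm a b ((branchLin a b 1)^[j] d) ≠ 0 ∧
      |((branchLin a b 1)^[j] d).2| ≤
        (9 / 10 + (1 / 2) ^ j * r) * |stableForm a b ((branchLin a b 1)^[j] d)| := by
    intro j
    induction j with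
    | zero =>
      refine ⟨hd, ?_⟩
      have h4 : |d.2| = r * |stableForm a b d| := by
        rw [hr, div_mul_cancel₀]; exact abs_ne_zero.2 hd
      simp only [Function.iterate_zero, id_eq, pow_zero, one_mul]
      rw [h4, add_mul]
      have := abs_nonneg (stableForm a b d)
      linarith
    | succ j ih =>
      obtain ⟨i1, i2⟩ := ih
      rw [Function.iterate_succ_apply']
      set e := (branchLin a b 1)^[j] d
      have h5 := abs_pos.2 i1
      rw [stableForm_branchLin h]
      refine ⟨mul_ne_zero (by linarith) i1, ?_⟩
      have h6 : (branchLin a b 1 e).2 = stableForm a b e + stableEig a b * e.2 := by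
        simp [branchLin, stableForm]
      have h7 : |(branchLin a b 1 e).2| ≤ |stableForm a b e| + 1 / 100 * |e.2| := by
        rw [h6]
        refine (abs_add_le _ _).trans ?_
        rw [abs_mul]
        gcongr
      rw [abs_mul, abs_neg, abs_of_pos (show 0 < a + stableEig a b by linarith)]
      have h8 : 0 ≤ (1 / 2 : ℝ) ^ j * r := by positivity
      have h9 : (9 / 10 + (1 / 2 : ℝ) ^ (j + 1) * r) * (18 / 10 * |stableForm a b e|) ≤
          (9 / 10 + (1 / 2 : ℝ) ^ (j + 1) * r) * ((a + stableEig a b) * |stableForm a b e|) := by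
        gcongr
        linarith
      refine le_trans ?_ h9
      rw [pow_succ]
      nlinarith
  obtain ⟨j, hj⟩ : ∃ j : ℕ, (1 / 2 : ℝ) ^ j * r ≤ 1 / 20 := by
    have : Tendsto (fun j : ℕ => (1 / 2 : ℝ) ^ j * r) atTop (𝓝 (0 * r)) :=
      (tendsto_pow_atTop_nhds_zero_of_lt_one (by norm_num) (by norm_num)).mul_const r
    rw [zero_mul] at this
    exact (this.eventually (ge_mem_nhds (by norm_num : (0 : ℝ) < 1 / 20))).exists
  obtain ⟨k1, k2⟩ := key j
  set e := (branchLin a b 1)^[j] d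
  have h5 := abs_pos.2 k1
  have h6 : |e.2| ≤ 19 / 20 * |stableForm a b e| := by nlinarith
  have h7 : |stableForm a b e| ≤ |e.1| + 1 / 100 * |e.2| := by
    refine (abs_sub _ _).trans ?_
    rw [abs_mul]
    gcongr
  refine ⟨j, by linarith, ?_⟩
  apply abs_pos.1
  linarith

/-- A germ in another direction can be pushed forward into the unstable cone. There an interval of
parameters would be covered by countably many countable sets, contradicting its positive length. -/
theorem HasStableGerm.stableForm_eq_zero (h : Expanding a b) {d : ℝ × ℝ}
    (hd : HasStableGerm a b d) : stableForm a b d = 0 := by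
  by_contra hne
  obtain ⟨j, hj1, hj2⟩ := exists_iterate_in_cone h hne
  have hg : ∀ j : ℕ, HasStableGerm a b ((Lozi.branchLin a b 1)^[j] d) := by
    intro j
    induction j with
    | zero => exact hd
    | succ j ih => rw [Function.iterate_succ_apply']; exact ih.branchLin h
  obtain ⟨ε, hε, hW⟩ := hg j
  set e := (Lozi.branchLin a b 1)^[j] d
  have hc : (Icc (0 : ℝ) ε).Countable := by
    refine (countable_iUnion fun k =>
      countable_stableForm_eq_zero h k (zPlus a b) e hj1 hj2).mono ?_
    intro t ht
    exact mem_iUnion.2 (exists_stableForm_eq_zero h (hW t ht))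
  have := hc.measure_zero MeasureTheory.volume
  rw [Real.volume_Icc, sub_zero, ENNReal.ofReal_eq_zero] at this
  linarith

theorem val_stableLine_iff {v : ℝ × ℝ} :
    v.1 = (stableLine a b).val v.2 ↔ stableForm a b (v - zPlus a b) = 0 := by
  simp only [stableLine, Line.val, stableForm, zPlus, Prod.fst_sub, Prod.snd_sub]
  constructor <;> intro h <;> linarith

theorem map_of_mem_stableLine (h : Expanding a b) {v : ℝ × ℝ} (hv : v ∈ (stableLine a b).seg) :
    map a b v = zPlus a b + stableEig a b • (v - zPlus a b) ∧ map a b v ∈ (stableLine a b).seg := by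
  obtain ⟨hs, hv1⟩ := hv
  have hpos := stableLine_pos h hs
  have hm := map_zPlus_add h (d := v - zPlus a b) (by rw [add_sub_cancel]; linarith)
  rw [add_sub_cancel] at hm
  have hf := val_stableLine_iff.1 hv1
  have hr := stableEig_root h
  constructor
  · rw [hm]
    congr 1
    simp only [stableForm] at hf
    ext
    · simp only [branchLin, sgn_one, LinearMap.coe_mk, AddHom.coe_mk, Prod.smul_fst, smul_eq_mul]
      linear_combination (-(a + stableEig a b)) * hf - (v - zPlus a b).2 * hr
    · simp only [branchLin, LinearMap.coe_mk, AddHom.coe_mk, Prod.smul_snd, smul_eq_mul]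
      linear_combination hf
  · refine ⟨?_, ?_⟩
    · change v.1 ∈ Icc (-1 : ℝ) 1
      rw [hv1]
      exact (stableLine_crosses h).val_mem hs
    · rw [val_stableLine_iff, hm, add_sub_cancel_left, stableForm_branchLin h, hf, mul_zero]

theorem seg_stableLine_subset_stableSet (h : Expanding a b) {v : ℝ × ℝ}
    (hv : v ∈ (stableLine a b).seg) : v ∈ stableSet a b (zPlus a b) := by
  have key : ∀ k : ℕ, (map a b)^[k] v ∈ (stableLine a b).seg ∧
      (map a b)^[k] v = zPlus a b + stableEig a b ^ k • (v - zPlus a b) := by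
    intro k
    induction k with
    | zero => exact ⟨hv, by simp⟩
    | succ k ih =>
      obtain ⟨i1, i2⟩ := ih
      obtain ⟨j1, j2⟩ := map_of_mem_stableLine h i1
      rw [Function.iterate_succ_apply']
      refine ⟨j2, ?_⟩
      rw [j1, i2, add_sub_cancel_left, smul_smul, pow_succ']
  have h1 := stableEig_nonpos h
  have h2 := le_stableEig h
  have hlim : Tendsto (fun k : ℕ => zPlus a b + stableEig a b ^ k • (v - zPlus a b)) atTop
      (𝓝 (zPlus a b + (0 : ℝ) • (v - zPlus a b))) :=
    tendsto_const_nhds.add ((tendsto_pow_atTop_nhds_zero_of_abs_lt_one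
      (by rw [abs_of_nonpos h1]; linarith)).smul_const _)
  rw [zero_smul, add_zero] at hlim
  exact hlim.congr fun k => (key k).2.symm

theorem localStable_inter_strip (h : Expanding a b) :
    localStable a b (zPlus a b) ∩ strip = (stableLine a b).seg := by
  ext v
  constructor
  · rintro ⟨hv, hs⟩
    refine ⟨hs, val_stableLine_iff.2 (HasStableGerm.stableForm_eq_zero h ⟨1, one_pos, ?_⟩)⟩
    intro t ht
    refine hv ?_
    rw [segment_eq_image']
    exact ⟨t, ht, rfl⟩
  · intro hv
    refine ⟨?_, hv.1⟩
    intro u hu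
    rw [segment_eq_image'] at hu
    obtain ⟨t, ht, rfl⟩ := hu
    refine seg_stableLine_subset_stableSet h ⟨?_, ?_⟩
    · have h1 := hv.1
      have h2 := zetaPlus_lower h
      have h3 := zetaPlus_lt_one h
      simp only [strip, mem_ofPred_eq, mem_Icc, zPlus, Prod.snd_add, Prod.smul_snd, Prod.snd_sub,
        smul_eq_mul] at h1 ⊢
      constructor <;> nlinarith [ht.1, ht.2, h1.1, h1.2]
    · have h1 := val_stableLine_iff.1 hv.2
      rw [val_stableLine_iff, add_sub_cancel_left]
      have : stableForm a b (t • (v - zPlus a b)) = t * stableForm a b (v - zPlus a b) := by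
        simp only [stableForm, Prod.smul_fst, Prod.smul_snd, smul_eq_mul]; ring
      rw [this, h1, mul_zero]

end stable

/-! ### The partition -/

/-- The line carrying `β_{k+1}`. -/
noncomputable def betaLine (a b : ℝ) (k : ℕ) : Line :=
  (Line.pull a b (-1))^[k] (stableLine a b)

/-- The line carrying `γ_{k+1}`. -/
noncomputable def gammaLine (a b : ℝ) (k : ℕ) : Line := (betaLine a b k).pull a b 1

section

variable {a b : ℝ}

theorem betaLine_succ (a b : ℝ) (k : ℕ) :
    betaLine a b (k + 1) = (betaLine a b k).pull a b (-1) :=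
  Function.iterate_succ_apply' _ _ _

theorem betaLine_crosses (h : Expanding a b) (k : ℕ) : (betaLine a b k).Crosses :=
  (stableLine_crosses h).iterate_pull h k

theorem gammaLine_crosses (h : Expanding a b) (k : ℕ) : (gammaLine a b k).Crosses :=
  (betaLine_crosses h k).pull h 1

theorem beta_eq_seg (h : Expanding a b) (k : ℕ) : beta a b (k + 1) = (betaLine a b k).seg := by
  induction k with
  | zero => exact localStable_inter_strip h
  | succ k ih =>
    change pullback a b (-1) (beta a b (k + 1)) = _
    rw [ih, pullback_seg h (betaLine_crosses h k), betaLine_succ]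

theorem gamma_eq_seg (h : Expanding a b) (k : ℕ) : gamma a b (k + 1) = (gammaLine a b k).seg := by
  rw [gamma, beta_eq_seg h, pullback_seg h (betaLine_crosses h k), gammaLine]

theorem betaLine_strict (h : Expanding a b) (k : ℕ) :
    (betaLine a b (k + 1)).StrictLeftOf (betaLine a b k) := by
  have h1 : ((stableLine a b).pull a b (-1)).StrictLeftOf (stableLine a b) := fun y hy =>
    (pull_neg_stableLine_neg h hy).trans (stableLine_pos h hy)
  exact h1.iterate_pull h ((stableLine_crosses h).pull h _) (stableLine_crosses h) k

theorem gammaLine_strict (h : Expanding a b) (k : ℕ) :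
    (gammaLine a b k).StrictLeftOf (gammaLine a b (k + 1)) :=
  (betaLine_strict h k).pull_one h (betaLine_crosses h _) (betaLine_crosses h _)

theorem betaLine_one_neg (h : Expanding a b) {y : ℝ} (hy : y ∈ Icc (-1 : ℝ) 1) :
    (betaLine a b 1).val y < 0 :=
  pull_neg_stableLine_neg h hy

theorem betaLine_succ_neg (h : Expanding a b) (k : ℕ) {y : ℝ} (hy : y ∈ Icc (-1 : ℝ) 1) :
    (betaLine a b (k + 1)).val y < 0 := by
  induction k with
  | zero => exact betaLine_one_neg h hy
  | succ k ih => exact (betaLine_strict h (k + 1) y hy).trans ih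

theorem stableLine_leftOf_gammaLine (h : Expanding a b) (k : ℕ) :
    (stableLine a b).LeftOf (gammaLine a b k) := by
  intro y hy
  induction k with
  | zero =>
    change _ ≤ ((stableLine a b).pull a b 1).val y
    rw [pull_stableLine h]
  | succ k ih => exact ih.trans (gammaLine_strict h k y hy).le

theorem C_eq_lineRegion (h : Expanding a b) (k : ℕ) :
    C a b (k + 2) = lineRegion (gammaLine a b k) (gammaLine a b (k + 1)) := by
  rw [C, show k + 2 - 1 = k + 1 by omega, gamma_eq_seg h, gamma_eq_seg h (k + 1),
    between_seg (gammaLine_strict h k).leftOf]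

/-- Lower bound for the segments `β_k`. -/
theorem betaLine_lower (h : Expanding a b) (ha : a ≤ 3) (k : ℕ) {y : ℝ}
    (hy : y ∈ Icc (-1 : ℝ) 1) : (1 / 3 : ℝ) ^ k - 1 ≤ (betaLine a b k).val y := by
  induction k generalizing y with
  | zero =>
    have := stableLine_pos h hy
    simp only [pow_zero, sub_self]
    exact this.le
  | succ k ih =>
    have hc := betaLine_crosses h k
    have h1 := branch_pull_val h hc (-1) y
    rw [← betaLine_succ] at h1
    have hx := (betaLine_crosses h (k + 1)).val_mem hy
    have h2 := ih hx
    rw [← h1] at h2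
    simp only [branch, sgn_neg_one] at h2
    have h3 := mul_nonneg h.nonneg (show 0 ≤ y + 1 by linarith [hy.1])
    have h4 : 0 ≤ (betaLine a b (k + 1)).val y + 1 := by linarith [hx.1]
    rw [pow_succ]
    nlinarith

/-- The segment `γ_n` stays on the left of the image of the critical locus. -/
theorem gammaLine_icpt_lt (h : Expanding a b) {k : ℕ}
    (hH : 3 ≤ a ∨ a * (2 - a) + 2 * a * b < (1 / 3) ^ k) :
    (gammaLine a b k).icpt < a - b - 1 - b := by
  have h0 : (0 : ℝ) ∈ Icc (-1 : ℝ) 1 := by constructor <;> norm_num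
  have hval : (gammaLine a b k).val 0 = (gammaLine a b k).icpt := by simp [Line.val]
  have hx := (gammaLine_crosses h k).val_mem h0
  rw [hval] at hx
  rcases le_or_gt 3 a with ha | ha
  · linarith [hx.2, h.b_le]
  have hH' := hH.resolve_left (by linarith)
  have h1 := branch_pull_val h (betaLine_crosses h k) 1 0
  change (branch a b 1 ((gammaLine a b k).val 0, 0)).1 =
    (betaLine a b k).val ((gammaLine a b k).val 0) at h1
  rw [hval] at h1
  -- `Λ_+` sends the point of `γ_{k+1}` at height `0` onto `β_{k+1}`, which stays at distance at
  -- least `3 ^ (-k)` to the right of `x = -1`. An intercept of at least `a - 2 b - 1` would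
  -- contradict `hH`.
  have h2 := betaLine_lower h ha.le k hx
  rw [← h1] at h2
  simp only [branch, sgn_one] at h2
  have := h.le_a
  have := h.nonneg
  by_contra! hcon
  nlinarith

/-- The image of `x = 0` over `I^V` lies at height `0` with first coordinate at least `a - b - 1 -
b`. A line whose intercept is smaller has its two preimages strictly on opposite sides of the
critical locus. -/
theorem pull_one_pos {l : Line} (h : Expanding a b) (hl : l.Crosses)
    (hi : l.icpt < a - b - 1 - b) {y : ℝ} (hy : y ∈ Icc (-1 : ℝ) 1) : 0 < (l.pull a b 1).val y := by
  have h1 := hl.pos_den h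
  have h2 : (l.pull a b 1).val y = (-b * y + (a - b - 1 - l.icpt)) / (a + l.slope) := by
    simp only [Line.pull, Line.val, sgn_one, one_mul]; ring
  rw [h2]
  refine div_pos ?_ h1
  nlinarith [hy.2, h.nonneg]

theorem pull_neg_one_neg {l : Line} (h : Expanding a b) (hl : l.Crosses)
    (hi : l.icpt < a - b - 1 - b) {y : ℝ} (hy : y ∈ Icc (-1 : ℝ) 1) :
    (l.pull a b (-1)).val y < 0 := by
  have h1 := hl.neg_den h
  have h2 : (l.pull a b (-1)).val y = (-b * y + (a - b - 1 - l.icpt)) / (-a + l.slope) := by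
    simp only [Line.pull, Line.val, sgn_neg_one, neg_one_mul]; ring
  rw [h2]
  refine div_neg_of_pos_of_neg ?_ h1
  nlinarith [hy.2, h.nonneg]

/-- Passage from `V(β_{k+2}, β_{k+1})` to `V(β_2, β_1)`. -/
theorem iterate_of_mem_beta_region (h : Expanding a b) (k : ℕ) :
    ∀ w ∈ lineRegion (betaLine a b (k + 1)) (betaLine a b k),
      (map a b)^[k] w = formalIter a b (List.replicate k (-1)) w ∧
      (map a b)^[k] w ∈ lineRegion (betaLine a b 1) (stableLine a b) := by
  induction k with
  | zero => exact fun w hw => ⟨rfl, hw⟩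
  | succ k ih =>
    rintro w ⟨hs, h1, h2⟩
    have hneg := betaLine_succ_neg h k hs
    have hmap := map_eq_branch_neg_one (a := a) (b := b) (h2.trans hneg.le)
    rw [betaLine_succ a b (k + 1)] at h1
    have hl := (le_branch_neg_one_iff h (betaLine_crosses h (k + 1))).2 h1
    have h2' := h2
    rw [betaLine_succ a b k] at h2'
    have hr := (branch_neg_one_le_iff h (betaLine_crosses h k)).2 h2'
    rw [Function.iterate_succ_apply, hmap, List.replicate_succ, formalIter_cons]
    refine ih _ ⟨?_, hl, hr⟩
    change w.1 ∈ Icc (-1 : ℝ) 1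
    rw [← betaLine_succ a b (k + 1)] at h1
    exact ⟨((betaLine_crosses h (k + 2)).val_mem hs).1.trans h1,
      h2.trans ((betaLine_crosses h (k + 1)).val_mem hs).2⟩

/-- Passage from `C_{k+2}` to `V(β_2, β_1)`. -/
theorem iterate_of_mem_C (h : Expanding a b) (k : ℕ) {v : ℝ × ℝ} (hv : v ∈ C a b (k + 2)) :
    (map a b)^[k + 1] v = formalIter a b (List.replicate k (-1)) (branch a b 1 v) ∧
      (map a b)^[k + 1] v ∈ lineRegion (betaLine a b 1) (stableLine a b) := by
  rw [C_eq_lineRegion h] at hv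
  obtain ⟨hs, h1, h2⟩ := hv
  have hpos : 0 < v.1 :=
    (stableLine_pos h hs).trans_le ((stableLine_leftOf_gammaLine h k _ hs).trans h1)
  rw [Function.iterate_succ_apply, map_eq_branch_one hpos.le]
  refine iterate_of_mem_beta_region h k _ ⟨?_, ?_, ?_⟩
  · exact ⟨by change -1 ≤ v.1; linarith, h2.trans ((gammaLine_crosses h (k + 1)).val_mem hs).2⟩
  · exact (le_branch_one_iff h (betaLine_crosses h (k + 1))).2 h2
  · exact (branch_one_le_iff h (betaLine_crosses h k)).2 h1

/-- The line sent to `l` by `Λ_-^k ∘ Λ_+`. -/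
noncomputable def pullBlock (a b : ℝ) (k : ℕ) (l : Line) : Line :=
  ((Line.pull a b (-1))^[k] l).pull a b 1

theorem pullBlock_stableLine (a b : ℝ) (k : ℕ) :
    pullBlock a b k (stableLine a b) = gammaLine a b k := rfl

theorem pullBlock_betaLine_one (a b : ℝ) (k : ℕ) :
    pullBlock a b k (betaLine a b 1) = gammaLine a b (k + 1) := rfl

theorem pullBlock_le_iff (h : Expanding a b) {l : Line} (hl : l.Crosses) (k : ℕ) {v : ℝ × ℝ} :
    (pullBlock a b k l).val v.2 ≤ v.1 ↔
    (formalIter a b (List.replicate k (-1)) (branch a b 1 v)).1 ≤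
      l.val (formalIter a b (List.replicate k (-1)) (branch a b 1 v)).2 := by
  rw [formalIter_replicate_le_iff h hl, branch_one_le_iff h (hl.iterate_pull h k), pullBlock]

theorem le_pullBlock_iff (h : Expanding a b) {l : Line} (hl : l.Crosses) (k : ℕ) {v : ℝ × ℝ} :
    v.1 ≤ (pullBlock a b k l).val v.2 ↔
    l.val (formalIter a b (List.replicate k (-1)) (branch a b 1 v)).2 ≤
      (formalIter a b (List.replicate k (-1)) (branch a b 1 v)).1 := by
  rw [le_formalIter_replicate_iff h hl, le_branch_one_iff h (hl.iterate_pull h k), pullBlock]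

theorem pullBlock_leftOf (h : Expanding a b) {l l' : Line} (hl : l.Crosses) (hl' : l'.Crosses)
    (hll : l.LeftOf l') (k : ℕ) : (pullBlock a b k l').LeftOf (pullBlock a b k l) :=
  (hll.iterate_pull h hl hl' k).pull_one h (hl.iterate_pull h k) (hl'.iterate_pull h k)

theorem pullBlock_strictLeftOf (h : Expanding a b) {l l' : Line} (hl : l.Crosses)
    (hl' : l'.Crosses) (hll : l.StrictLeftOf l') (k : ℕ) :
    (pullBlock a b k l').StrictLeftOf (pullBlock a b k l) :=
  (hll.iterate_pull h hl hl' k).pull_one h (hl.iterate_pull h k) (hl'.iterate_pull h k)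

/-- The preimage in `C_{k+2}` of the region between two lines in `V(β_2, β_1)`. -/
theorem mem_lineRegion_pullBlock_iff (h : Expanding a b) {l l' : Line} (hl : l.Crosses)
    (hl' : l'.Crosses) (h1 : (betaLine a b 1).LeftOf l) (h2 : l'.LeftOf (stableLine a b)) (k : ℕ)
    {v : ℝ × ℝ} :
    v ∈ lineRegion (pullBlock a b k l') (pullBlock a b k l) ↔
      v ∈ C a b (k + 2) ∧ (map a b)^[k + 1] v ∈ lineRegion l l' := by
  constructor
  · rintro ⟨hs, h3, h4⟩
    have hC : v ∈ C a b (k + 2) := by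
      rw [C_eq_lineRegion h]
      exact ⟨hs, (pullBlock_leftOf h hl' (stableLine_crosses h) h2 k _ hs).trans h3,
        h4.trans (pullBlock_leftOf h (betaLine_crosses h 1) hl h1 k _ hs)⟩
    obtain ⟨i1, i2⟩ := iterate_of_mem_C h k hC
    refine ⟨hC, i2.1, ?_, ?_⟩
    · rw [i1]; exact (le_pullBlock_iff h hl k).1 h4
    · rw [i1]; exact (pullBlock_le_iff h hl' k).1 h3
  · rintro ⟨hC, -, h3, h4⟩
    obtain ⟨i1, i2⟩ := iterate_of_mem_C h k hC
    rw [C_eq_lineRegion h] at hC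
    rw [i1] at h3 h4
    exact ⟨hC.1, (pullBlock_le_iff h hl' k).2 h4, (le_pullBlock_iff h hl k).2 h3⟩

/-- The region `C_{m,n}` is a pair of vertical strips. -/
theorem isLeftRight_Cmn (h : Expanding a b) (k j : ℕ)
    (hi : (gammaLine a b (j + 1)).icpt < a - b - 1 - b) :
    IsLeftRight (Cmn a b (k + 2) (j + 2))
      (lineRegion (pullBlock a b k ((gammaLine a b j).pull a b 1))
        (pullBlock a b k ((gammaLine a b (j + 1)).pull a b 1)))
      (lineRegion (pullBlock a b k ((gammaLine a b (j + 1)).pull a b (-1)))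
        (pullBlock a b k ((gammaLine a b j).pull a b (-1)))) := by
  have c1 := gammaLine_crosses h j
  have c2 := gammaLine_crosses h (j + 1)
  have hlt := gammaLine_strict h j
  -- The next four facts place both preimages of `C_n` inside `V(β_2, β_1)`, where the first `m - 1`
  -- iterates of `C_m` arrive.
  have p1 : (betaLine a b 1).LeftOf ((gammaLine a b (j + 1)).pull a b 1) := fun y hy =>
    (betaLine_one_neg h hy).le.trans (pull_one_pos h c2 hi hy).le
  have p2 : ((gammaLine a b j).pull a b 1).LeftOf (stableLine a b) := by
    have := (stableLine_leftOf_gammaLine h j).pull_one h (stableLine_crosses h) c1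
    rwa [pull_stableLine h] at this
  have n1 : (betaLine a b 1).LeftOf ((gammaLine a b j).pull a b (-1)) :=
    (stableLine_leftOf_gammaLine h j).pull_neg_one h (stableLine_crosses h) c1
  have n2 : ((gammaLine a b (j + 1)).pull a b (-1)).LeftOf (stableLine a b) := fun y hy =>
    (pull_neg_one_neg h c2 hi hy).le.trans (stableLine_pos h hy).le
  have hmid : ((gammaLine a b (j + 1)).pull a b (-1)).StrictLeftOf
      ((gammaLine a b (j + 1)).pull a b 1) := fun y hy =>
    (pull_neg_one_neg h c2 hi hy).trans (pull_one_pos h c2 hi hy)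
  refine ⟨isVerticalStrip_lineRegion (pullBlock_strictLeftOf h (c2.pull h _) (c1.pull h _)
    (hlt.pull_one h c1 c2) k), isVerticalStrip_lineRegion (pullBlock_strictLeftOf h (c1.pull h _)
    (c2.pull h _) (hlt.pull_neg_one h c1 c2) k), ?_, ?_⟩
  · ext v
    rw [mem_union, mem_lineRegion_pullBlock_iff h (c2.pull h _) (c1.pull h _) p1 p2,
      mem_lineRegion_pullBlock_iff h (c1.pull h _) (c2.pull h _) n1 n2]
    -- The condition of lying in `U_m` is automatic. With `m = k + 2`, the last of the `m` iterates
    -- is split off, since only there can both branches occur.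
    have hCmn : v ∈ Cmn a b (k + 2) (j + 2) ↔ v ∈ C a b (k + 2) ∧
        map a b ((map a b)^[k + 1] v) ∈ C a b (j + 2) := by
      rw [← Function.iterate_succ_apply' (map a b)]
      exact ⟨fun hv => ⟨hv.1, hv.2.2⟩, fun hv => ⟨hv.1, mem_image_of_mem _ hv.1, hv.2⟩⟩
    rw [hCmn, ← and_or_left]
    refine and_congr_right fun hC => ?_
    obtain ⟨-, hu, hu1, hu2⟩ := iterate_of_mem_C h k hC
    set u := (map a b)^[k + 1] v
    rw [C_eq_lineRegion h]
    have hu' : u.1 ∈ Icc (-1 : ℝ) 1 :=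
      ⟨((betaLine_crosses h 1).val_mem hu).1.trans hu1,
        hu2.trans ((stableLine_crosses h).val_mem hu).2⟩
    constructor
    · rintro ⟨-, h1, h2⟩
      rcases le_total 0 u.1 with h0 | h0
      · rw [map_eq_branch_one h0] at h1 h2
        exact Or.inl ⟨hu, (branch_one_le_iff h c2).1 h2, (le_branch_one_iff h c1).1 h1⟩
      · rw [map_eq_branch_neg_one h0] at h1 h2
        exact Or.inr ⟨hu, (le_branch_neg_one_iff h c1).1 h1, (branch_neg_one_le_iff h c2).1 h2⟩
    · rintro (⟨-, h1, h2⟩ | ⟨-, h1, h2⟩)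
      · have h0 : 0 ≤ u.1 := (pull_one_pos h c2 hi hu).le.trans h1
        rw [map_eq_branch_one h0]
        exact ⟨hu', (le_branch_one_iff h c1).2 h2, (branch_one_le_iff h c2).2 h1⟩
      · have h0 : u.1 ≤ 0 := h2.trans (pull_neg_one_neg h c2 hi hu).le
        rw [map_eq_branch_neg_one h0]
        exact ⟨hu', (le_branch_neg_one_iff h c1).2 h1, (branch_neg_one_le_iff h c2).2 h2⟩
  -- `pullBlock` reverses order, so the left strip comes from the preimage in `x > 0`, matching the
  -- second `+` of the itinerary.
  · rintro p ⟨hp, -, h1⟩ q ⟨-, h2, -⟩ hpq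
    have := pullBlock_strictLeftOf h (c2.pull h _) (c2.pull h _) hmid k p.2 hp
    rw [← hpq] at h2
    linarith

/-- Membership in `C_{m,n}^L` in terms of the last point of the orbit along the stem. -/
theorem mem_CmnL_of_formalIter (h : Expanding a b) (k j : ℕ)
    (hi : (gammaLine a b (j + 1)).icpt < a - b - 1 - b) {v : ℝ × ℝ} (hv : v ∈ strip)
    (h1 : (formalIter a b (iotaStem (k + 2) (j + 2)) v).1 ≤
      (stableLine a b).val (formalIter a b (iotaStem (k + 2) (j + 2)) v).2)
    (h2 : (betaLine a b 1).val (formalIter a b (iotaStem (k + 2) (j + 2)) v).2 ≤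
      (formalIter a b (iotaStem (k + 2) (j + 2)) v).1) :
    v ∈ CmnL a b (k + 2) (j + 2) := by
  have c1 := gammaLine_crosses h j
  have c2 := gammaLine_crosses h (j + 1)
  have hstem : formalIter a b (iotaStem (k + 2) (j + 2)) v =
      formalIter a b (List.replicate j (-1)) (branch a b 1 (branch a b 1
        (formalIter a b (List.replicate k (-1)) (branch a b 1 v)))) := by
    simp only [iotaStem, formalIter_append, formalIter_cons, formalIter_nil, Nat.add_sub_cancel]
  rw [hstem] at h1 h2
  refine ⟨_, _, isLeftRight_Cmn h k j hi, hv, ?_, ?_⟩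
  · rw [pullBlock_le_iff h (c1.pull h 1), ← le_branch_one_iff h c1,
      ← pullBlock_stableLine, pullBlock_le_iff h (stableLine_crosses h)]
    exact h1
  · rw [le_pullBlock_iff h (c2.pull h 1), ← branch_one_le_iff h c2,
      ← pullBlock_betaLine_one, le_pullBlock_iff h (betaLine_crosses h 1)]
    exact h2

/-- It suffices that the last point `q` of the orbit lies between `β_2` and `β_1`. As `w 2 < 0`, the
point `θ` lies right of the invariant stable line; pulling this back by `σ` gives one side for `q`,
and the sign of `q.1` gives the other. -/
theorem mem_CmnL_of_hasIotaSigns (h : Expanding a b) {m n : ℕ} {σ : ℤˣ} {θ : ℝ × ℝ} (hm : 3 ≤ m)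
    (hn : 2 ≤ n) (hH : 3 ≤ a ∨ a * (2 - a) + 2 * a * b < (1 / 3) ^ (n - 1))
    (hθ : IsFormalPeriodic a b (iota σ m n) θ)
    (hs : HasIotaSigns m n (orbitSeq a b (iota σ m n) θ))
    (hσ : 0 ≤ sgn σ * (formalIter a b (iotaStem m n) θ).1) : θ ∈ CmnL a b m n := by
  have hl := iota_length σ (show 2 ≤ m by omega) hn
  have hlJ := iotaStem_length (show 2 ≤ m by omega) hn
  have hB := orbitSeq_abs_le_one h.nonneg (by linarith [h.le_a, h.b_le])
    (List.ne_nil_of_length_pos (by omega)) hθ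
  set q := formalIter a b (iotaStem m n) θ with hq
  have hq2 : q.2 ∈ Icc (-1 : ℝ) 1 := by
    have := hB (m + n - 1) (by omega)
    rw [iota, orbitSeq_append _ _ _ _ _ (by omega), ← hlJ, orbitSeq_length] at this
    exact abs_le.1 this
  have hθs : θ ∈ strip := abs_le.1 (hB 0 (by omega))
  have hθ1 : θ.1 ∈ Icc (-1 : ℝ) 1 := by
    have := hB 1 (by omega)
    simp only [orbitSeq, List.take_zero, formalIter_nil] at this
    exact abs_le.1 this
  have hback : branch a b σ q = θ := by
    conv_rhs => rw [hθ, iota, formalIter_append]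
    rfl
  have hfst : (stableLine a b).val θ.2 ≤ θ.1 := by
    have h1 := branch_one_le_iff h (stableLine_crosses h) (v := θ)
    rw [pull_stableLine h] at h1
    refine h1.1 ?_
    have h2 := hs.block₁ 2 le_rfl (by omega)
    have h3 : orbitSeq a b (iota σ m n) θ 2 = (branch a b 1 θ).1 := by
      have := formalIter_take_succ a b (iota σ m n) θ (k := 0) (by omega)
      rw [iota_getElem (by omega) hn, if_neg (by omega), if_pos (by simp)] at this
      simp only [orbitSeq, zero_add] at this ⊢
      rw [this]
      rfl
    rw [h3] at h2
    exact h2.le.trans (stableLine_pos h (y := θ.1) hθ1).le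
  obtain ⟨k, rfl⟩ := Nat.exists_eq_add_of_le' (show 2 ≤ m by omega)
  obtain ⟨j, rfl⟩ := Nat.exists_eq_add_of_le' hn
  refine mem_CmnL_of_formalIter h k j (gammaLine_icpt_lt h hH) hθs ?_ ?_
  · rw [← hq]
    rcases Int.units_eq_one_or σ with rfl | rfl
    · have h1 := le_branch_one_iff h (stableLine_crosses h) (v := q)
      rw [pull_stableLine h, hback] at h1
      exact h1.1 hfst
    · rw [sgn_neg_one] at hσ
      linarith [stableLine_pos h hq2]
  · rw [← hq]
    rcases Int.units_eq_one_or σ with rfl | rfl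
    · rw [sgn_one] at hσ
      linarith [betaLine_one_neg h hq2]
    · have h1 := le_branch_neg_one_iff h (stableLine_crosses h) (v := q)
      rw [hback] at h1
      exact h1.1 hfst

end

/-! ### The bifurcation curve -/

theorem two_thirds_pow_le {N m : ℕ} (hm : 3 * N + 20 ≤ m) :
    (2 / 3 : ℝ) ^ (m - 2) ≤ 1 / 1000 * (1 / 3) ^ N := by
  -- Uses `(2 / 3) ^ 3 = 8 / 27 ≤ 1 / 3` and `(2 / 3) ^ 18 ≤ 1 / 1000`.
  calc (2 / 3 : ℝ) ^ (m - 2) ≤ (2 / 3) ^ (18 + 3 * N) :=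
        pow_le_pow_of_le_one (by norm_num) (by norm_num) (by omega)
    _ = (2 / 3) ^ 18 * ((2 / 3) ^ 3) ^ N := by rw [pow_add, pow_mul]
    _ ≤ 1 / 1000 * (1 / 3) ^ N := by
        gcongr <;> norm_num

theorem linear_mul_two_thirds_pow_le {m : ℕ} (hm : 20 ≤ m) :
    (3 * (m : ℝ) + 5) * (2 / 3) ^ (m - 2) ≤ 1 / 4 := by
  induction m, hm using Nat.le_induction with
  | base => norm_num
  | succ m hm ih =>
    have hm' : (20 : ℝ) ≤ m := by exact_mod_cast hm
    have h0 : 0 ≤ (2 / 3 : ℝ) ^ (m - 2) := by positivity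
    rw [show m + 1 - 2 = m - 2 + 1 by omega, pow_succ]
    push_cast
    nlinarith

/-- The bifurcation curve is the zero set of the gap. -/
theorem exists_bifurcation_curve {m n : ℕ} (hm : 20 ≤ m) (hn : 2 ≤ n) :
    ∃ l : ℝ → ℝ, ∀ b, |b| < 1 / 200 → AnalyticAt ℝ l b ∧ l b ∈ Ioo (3 / 2) 3 ∧
      (0 ≤ b → ∀ a, 3 * b + 1 < a → (l b < a → 0 < gap a b (iotaStem m n)) ∧
        (a = l b → gap a b (iotaStem m n) = 0) ∧ (a < l b → gap a b (iotaStem m n) < 0)) := by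
  have hq : (2 / 3 : ℝ) ^ (m - 2) ≤ 1 / 100 := by
    have := two_thirds_pow_le (N := 0) (m := m) (by omega)
    rw [pow_zero] at this
    linarith
  have hq' := linear_mul_two_thirds_pow_le hm
  have hexp : ∀ b, |b| < 1 / 200 → ∀ a₁ a₂, 3 / 2 ≤ a₁ → a₁ < a₂ →
      (a₂ - a₁) / 2 ≤ gap a₂ b (iotaStem m n) - gap a₁ b (iotaStem m n) :=
    fun b hb a₁ a₂ h1 h2 => gap_expanding h1 h2 hb.le (by omega) hn hq'
  obtain ⟨l, hl⟩ := exists_analytic_zero (F := fun q : ℝ × ℝ => gap q.2 q.1 (iotaStem m n))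
    (s := 3 / 2) (t := 3) (δ := 1 / 200) (by norm_num)
    (fun b a hb ha => analyticAt_gap (by linarith [ha.1]) _)
    (fun b hb a₁ a₂ h1 h2 _ => hexp b hb a₁ a₂ h1 h2)
    (fun b hb => gap_neg_left hb.le (by omega) hn hq)
    (fun b hb => gap_pos_right hb.le (by omega) hn hq)
  refine ⟨l, fun b hb => ?_⟩
  obtain ⟨h1, h2, h3⟩ := hl b hb
  refine ⟨h1, h2, fun hb0 a ha => ⟨fun h => ?_, fun h => by rw [h]; exact h3, fun h => ?_⟩⟩
  · have := hexp b hb _ _ h2.1.le h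
    linarith
  · rcases le_or_gt a (3 / 2) with h4 | h4
    · exact gap_neg_of_le hb0 ((le_abs_self b).trans hb.le) ha h4 (by omega) hn
    · have := hexp b hb _ _ h4.le h
      linarith

/-- A nonnegative gap puts the parameter in the expanding region, close to or beyond `a = 2`. -/
theorem expanding_of_gap_nonneg {a b : ℝ} {N m n : ℕ} (hm : 3 * N + 20 ≤ m) (hn : 2 ≤ n)
    (hnN : n ≤ N) (hb0 : 0 ≤ b) (hb : b ≤ 1 / 400 * (1 / 3) ^ N) (hab : 3 * b + 1 < a)
    (hg : 0 ≤ gap a b (iotaStem m n)) :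
    Expanding a b ∧ (3 ≤ a ∨ a * (2 - a) + 2 * a * b < (1 / 3) ^ (n - 1)) := by
  have hpow1 : (1 / 3 : ℝ) ^ N ≤ 1 := pow_le_one₀ (by norm_num) (by norm_num)
  have hpow0 : 0 < (1 / 3 : ℝ) ^ N := by positivity
  have hpown : (1 / 3 : ℝ) ^ N ≤ (1 / 3) ^ (n - 1) :=
    pow_le_pow_of_le_one (by norm_num) (by norm_num) (by omega)
  have hb400 : b ≤ 1 / 400 := by linarith
  have ha : 3 / 2 < a := by
    by_contra! h
    exact hg.not_gt (gap_neg_of_le hb0 (by linarith) hab h (by omega) hn)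
  have h1 := mul_two_sub_le_of_gap_nonneg ha.le hb0 (by linarith) (by omega) hn hg
  have h2 := two_thirds_pow_le hm
  have h3 : a * (2 - a) ≤ 3 / 100 * (1 / 3) ^ N := by linarith
  refine ⟨⟨?_, hb0, hb400⟩, ?_⟩
  -- For `3 / 2 < a < 19 / 10` the product `a (2 - a)` exceeds `19 / 100`, too large for `h3`.
  · by_contra! h
    nlinarith
  · rcases le_or_gt 3 a with h | h
    · exact Or.inl h
    · right
      nlinarith

end Lozi

/-! ### Assembly of the theorem. -/

theorem mainTheorem2 (N : ℕ) (hN : 2 ≤ N) :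
    ∃ bbar : ℝ, 0 < bbar ∧ bbar < 1 ∧ ∃ M : ℕ, N + 2 ≤ M ∧
      ∀ m n : ℕ, M ≤ m → 2 ≤ n → n ≤ N →
        ∃ l : ℝ → ℝ, AnalyticOnNhd ℝ l (Set.Icc 0 bbar) ∧
          (∀ b ∈ Set.Icc 0 bbar, l b ∈ Set.Ioo (Real.sqrt 2) 4 ∧ (l b, b) ∈ Lozi.Pnbd bbar) ∧
          ∀ a b : ℝ, (a, b) ∈ Lozi.Pnbd bbar →
            ∃ θ : ℤˣ → ℝ × ℝ,
              (∀ (σ : ℤˣ) (v : ℝ × ℝ),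
                Lozi.IsFormalPeriodic a b (Lozi.iota σ m n) v ↔ v = θ σ) ∧
              (l b < a → ∀ σ : ℤˣ,
                Lozi.IsHyperbolic a b (Lozi.iota σ m n) (θ σ) ∧ θ σ ∈ Lozi.CmnL a b m n) ∧
              (a = l b →
                Lozi.IsBifurcationParameter a b (Lozi.iotaStem m n) ∧
                θ (-1) = θ 1 ∧
                ∀ σ : ℤˣ, Lozi.IsAdmissible a b (Lozi.iota σ m n) (θ σ) ∧
                  θ σ ∈ Lozi.CmnL a b m n ∧
                  ((Lozi.map a b)^[m + n - 1] (θ σ)).1 = 0) ∧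
              (a < l b → ∀ σ : ℤˣ, ¬ Lozi.IsAdmissible a b (Lozi.iota σ m n) (θ σ)) := by
  have hpow1 : (1 / 3 : ℝ) ^ N ≤ 1 := pow_le_one₀ (by norm_num) (by norm_num)
  have hpow0 : 0 < (1 / 3 : ℝ) ^ N := by positivity
  -- Both `bbar` and `M` are chosen so that the errors in `b` and `(2 / 3) ^ (m - 2)` are small
  -- multiples of `3 ^ (-N)`, below the threshold `(1 / 3) ^ (n - 1)` for every `n ≤ N`.
  refine ⟨1 / 400 * (1 / 3) ^ N, by positivity, by linarith, 3 * N + 20, by omega, ?_⟩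
  intro m n hm hn hnN
  obtain ⟨l, hl⟩ := Lozi.exists_bifurcation_curve (m := m) (n := n) (by omega) hn
  have hbabs : ∀ b ∈ Set.Icc (0 : ℝ) (1 / 400 * (1 / 3) ^ N), |b| < 1 / 200 := by
    intro b hb
    rw [abs_of_nonneg hb.1]
    linarith [hb.2]
  refine ⟨l, fun b hb => (hl b (hbabs b hb)).1, fun b hb => ?_, fun a b hab => ?_⟩
  · obtain ⟨-, h1, -⟩ := hl b (hbabs b hb)
    have hb2 : b < 1 / 200 := (le_abs_self b).trans_lt (hbabs b hb)
    refine ⟨⟨lt_trans ?_ h1.1, by linarith [h1.2]⟩, ⟨?_, hb.1, ?_⟩, hb.1, hb.2⟩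
    · rw [Real.sqrt_lt' (by norm_num)]; norm_num
    · change 3 * b + 1 < l b
      linarith [h1.1]
    · change b ≤ 1
      linarith
  obtain ⟨⟨hab3, hb0, -⟩, -, hb1⟩ := hab
  simp only at hab3 hb0 hb1
  replace hab3 : 3 * b + 1 < a := hab3
  have hab1 : 1 + |b| < a := by rw [abs_of_nonneg hb0]; linarith
  obtain ⟨-, -, hsign⟩ := hl b (hbabs b ⟨hb0, hb1⟩)
  obtain ⟨hpos, hzero, hneg⟩ := hsign hb0 a hab3
  have hex : ∀ σ : ℤˣ, ∃! v, Lozi.IsFormalPeriodic a b (Lozi.iota σ m n) v := fun σ =>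
    Lozi.existsUnique_formalPeriodic hab1 (by simp [Lozi.iota])
  choose θ hθ huniq using hex
  simp only at hθ huniq
  have hgood : 0 ≤ Lozi.gap a b (Lozi.iotaStem m n) → ∀ σ : ℤˣ,
      Lozi.HasIotaSigns m n (Lozi.orbitSeq a b (Lozi.iota σ m n) (θ σ)) ∧
      0 ≤ Lozi.sgn σ * (Lozi.formalIter a b (Lozi.iotaStem m n) (θ σ)).1 ∧
      θ σ ∈ Lozi.CmnL a b m n := by
    intro hg σ
    obtain ⟨hE, hH⟩ := Lozi.expanding_of_gap_nonneg hm hn hnN hb0 hb1 hab3 hg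
    have hσ := Lozi.sgn_mul_nonneg_of_gap_nonneg hab1 (hθ σ) hg
    have hq := Lozi.two_thirds_pow_le hm
    have hs := Lozi.hasIotaSigns_of_periodic (by linarith [hE.le_a]) hb0 hE.b_le (by omega) hn
      (by linarith) hH (hθ σ) hσ
    exact ⟨hs, hσ, Lozi.mem_CmnL_of_hasIotaSigns hE (by omega) hn hH (hθ σ) hs hσ⟩
  refine ⟨θ, fun σ v => ⟨huniq σ v, fun h => h ▸ hθ σ⟩, fun h σ => ?_, fun h => ?_,
    fun h σ hadm => ?_⟩
  · obtain ⟨hs, hσ, hC⟩ := hgood (hpos h).le σ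
    exact ⟨Lozi.isHyperbolic_of_hasIotaSigns (by omega) hn (hθ σ) hs hσ
      (Lozi.formalIter_fst_ne_zero_of_gap_pos hab1 (hθ σ) (hpos h)), hC⟩
  · have hcrit : ∀ σ : ℤˣ, θ σ = (Lozi.critStart a b (Lozi.iotaStem m n), 0) := fun σ =>
      Lozi.eq_critStart_of_gap_eq_zero hab1 (hθ σ) (hzero h)
    have hadm : ∀ σ : ℤˣ, Lozi.IsAdmissible a b (Lozi.iota σ m n) (θ σ) := fun σ =>
      (hgood (hzero h).ge σ).1.isAdmissible (by omega) hn (hgood (hzero h).ge σ).2.1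
    have hlast : ∀ σ : ℤˣ, ((Lozi.map a b)^[m + n - 1] (θ σ)).1 = 0 := fun σ => by
      rw [(hadm σ).iterate_last (by omega) hn]
      exact Lozi.formalIter_fst_eq_zero_of_gap_eq_zero hab1 (hθ σ) (hzero h)
    have heq : ∀ σ : ℤˣ, θ σ = θ 1 := fun σ => (hcrit σ).trans (hcrit 1).symm
    refine ⟨⟨θ 1, fun σ => ?_, ?_⟩, heq _, fun σ =>
      ⟨hadm σ, (hgood (hzero h).ge σ).2.2, hlast σ⟩⟩
    · rw [← heq σ]
      exact ⟨hθ σ, hadm σ⟩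
    · rw [Lozi.iotaStem_length (by omega) hn]
      exact hlast 1
  -- Below the curve admissibility already fails at the last symbol.
  · have h1 := Lozi.sgn_mul_neg_of_gap_neg hab1 (hθ σ) (hneg h)
    have hlen := Lozi.iota_length σ (show 2 ≤ m by omega) hn
    have h2 := hadm (m + n - 1) (by omega)
    rw [Lozi.iota_getElem (by omega) hn, if_pos rfl] at h2
    change 0 ≤ Lozi.sgn σ * Lozi.orbitSeq a b (Lozi.iota σ m n) (θ σ) (m + n - 1 + 1) at h2
    rw [show m + n - 1 + 1 = m + n by omega, Lozi.orbitSeq_iota_last (by omega) hn] at h2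
    linarith
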